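/- Setting. Let $K\ge 1$, let $\mathcal S_1,\dots,\mathcal S_K\subseteq\mathbb R$ be closed, and let $f:\mathcal S_1\times\dots\times\mathcal S_K\to\mathbb R$ be in $\mathcal F_{\mathrm{mon}}$. That is, $f(s_1,\dots,s_K)=F\big(\sum_{k=1}^K f_k(s_k)\big)$ with bounded measurable $f_k:\mathcal S_k\to\mathbb R$ and a measurable $F:\mathcal D\to\mathbb R$ on a measurable set $\mathcal D\subseteq\mathbb R$ containing all sums $\sum_k f_k(s_k)$, and $\Phi:[0,\infty)\to[0,\infty)$ is an increment majorant: $\Phi$ is strictly increasing, $\Phi(0)=0$ and $|F(x)-F(y)|\le\Phi(|x-y|)$ for all $x,y\in\mathcal D$. Write $\phi_{\min,k}=\inf_{\mathcal S_k} f_k$, $\phi_{\max,k}=\sup_{\mathcal S_k} f_k$, $\bar\Delta(f)=\sum_k(\phi_{\max,k}-\phi_{\min,k})$, $\Delta(f)=\max_k(\phi_{\max,k}-\phi_{\min,k})$, and assume $\Delta(f)>0$. For $\varepsilon>0$ with $\varepsilon\le\Phi(t)$ for some $t\ge0$, put $\Phi^{-1}(\varepsilon)=\inf\{t\ge 0:\Phi(t)\ge\varepsilon\}$,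 which is the usual inverse if $\varepsilon$ is in the range of $\Phi$. For a real random variable $X$ let $\|X\|_{\psi_2}=\inf\{t>0:\ \mathbb E e^{\lambda(X-\mathbb EX)}\le e^{\lambda^2t^2/2}\ \forall\lambda\in\mathbb R\}$. Let $M\ge1$ be the number of channel uses and $P>0$ the power constraint. The channel is $Y(m)=\sum_{k=1}^K H_k(m)x_k(m)+N(m)$, $m=1,\dots,M$, with complex inputs $|x_k(m)|^2\le P$. The vector $H\in\mathbb R^{2KM}$ of the real and imaginary parts of all $H_k(m)$ and the vector $N\in\mathbb R^{2M}$ of the real and imaginary parts of all $N(m)$ are $H=AR$ and $N=BR$, where $A\in\mathbb R^{2KM\times(2KM+2M)}$, $B\in\mathbb R^{2M\times(2KM+2M)}$ and $R$ has independent entries with $\|R_j\|_{\psi_2}\le1$. All entries of $H$ have mean $0$ and variance $1$, and all entries of $N$ have mean $0$. Let $A_i\in\mathbb R^{2KM\times(2KM+2M)}$ be such that the fading vector $A_iR$ is user-uncorrelated (for each channel use and each of the two real dimensions, the entries of any two different users are independent), and let $\|(A+A_i)(A-A_i)^T\|_{\mathrm{op}}\le\eta$. Scheme. User $k$ sends $x_k(m)=\sqrt{a_k}\,U_k(m)$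 with $a_k=\frac{P}{\Delta(f)}(f_k(s_k)-\phi_{\min,k})\in[0,P]$, where the $U_k(m)$ are i.i.d. uniform on $\{-1,1\}$ and independent of $R$. The receiver outputs $$\bar f=\hat F\Big(\frac{\Delta(f)}{2MP}\big(\|Y\|_2^2-\mathbb E\|N\|_2^2\big)+\sum_{k}\phi_{\min,k}\Big),$$ where $\hat F:\mathbb R\to\mathbb R$ is a measurable extension of $F$ (so $\hat F=F$ if $\mathcal D=\mathbb R$). Theorem. There is a measurable extension $\hat F$ of $F$, chosen independently of $M$, $P$, the channel and $\varepsilon$, such that in the above setting, for all $(s_1,\dots,s_K)\in\mathcal S_1\times\dots\times\mathcal S_K$ and all $\varepsilon$ as above, $$\mathbb P\big(|\bar f-f(s_1,\dots,s_K)|\ge\varepsilon\big)\le 2\exp\Big(-\frac{M\Phi^{-1}(\varepsilon)^2}{16\mathsf F+\mathsf D+4\Phi^{-1}(\varepsilon)\mathsf L}\Big)+2\exp\Big(-\frac{M\Phi^{-1}(\varepsilon)^2}{256\mathsf F+32\Phi^{-1}(\varepsilon)\mathsf L}\Big),$$ where, with operator and Frobenius norms, $$\mathsf L=\Big(\sqrt{\bar\Delta(f)}\,\|A\|_{\mathrm{op}}+\sqrt{\tfrac{\Delta(f)}{P}}\,\|B\|_{\mathrm{op}}\Big)^2,\qquad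 \mathsf F=\mathsf L\Big(\sqrt{\tfrac{\bar\Delta(f)}{M}}\,\|A\|_F+\sqrt{\tfrac{\Delta(f)}{PM}}\,\|B\|_F\Big)^2,$$ $$\mathsf D=\Big(4\sqrt{2M}\,\bar\Delta(f)\,\eta+4\tfrac{\Delta(f)}{\sqrt{PM}}\,\|AB^T\|_F\Big)^2.$$ -/

import Mathlib

open MeasureTheory ProbabilityTheory
open scoped NNReal ENNReal Matrix

/-! ### Sub-Gaussian norm and matrix norms -/

/-- The sub-Gaussian norm
`inf {t > 0 | ∀ lam, E exp (lam (X - E X)) ≤ exp (lam² t² / 2)}`, with value `∞` if there is no such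
`t`. (Mathlib's `HasSubgaussianMGF` also asks that the exponentials be integrable.) -/
noncomputable def subGaussNorm {Ω : Type*} [MeasurableSpace Ω] (X : Ω → ℝ) (μ : Measure Ω) : ℝ≥0∞ :=
  ⨅ (t : ℝ≥0) (_ : 0 < t ∧ HasSubgaussianMGF (fun ω => X ω - μ[X]) (t ^ 2) μ), (t : ℝ≥0∞)

/-- Operator norm of a real matrix with respect to the Euclidean norms. -/
noncomputable def opNorm {m n : Type*} [Fintype m] [Fintype n] [DecidableEq n]
    (A : Matrix m n ℝ) : ℝ :=
  ‖LinearMap.toContinuousLinearMap (Matrix.toEuclideanLin A)‖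

/-- Frobenius norm of a real matrix. -/
noncomputable def frobNorm {m n : Type*} [Fintype m] [Fintype n] (A : Matrix m n ℝ) : ℝ :=
  √(∑ i, ∑ j, A i j ^ 2)

/-! ### The function class -/

/-- A representation `f (s₁, …, s_K) = F (f₁ s₁ + ⋯ + f_K s_K)` with bounded measurable inner
functions `f_k` on `S k` and a measurable outer function `F` on a measurable set `dom ⊆ ℝ`
that contains all the sums. -/
structure NomographicRep {K : ℕ} (S : Fin K → Set ℝ) (f : (∀ k, S k) → ℝ) where
  /-- the functions `f_k` -/
  inner : ∀ k, S k → ℝ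
  inner_measurable : ∀ k, Measurable (inner k)
  inner_bounded : ∀ k, ∃ C : ℝ, ∀ s, |inner k s| ≤ C
  /-- the domain of the outer function -/
  dom : Set ℝ
  dom_measurable : MeasurableSet dom
  sum_mem : ∀ s : ∀ k, S k, ∑ k, inner k (s k) ∈ dom
  /-- the outer function `F` -/
  outer : dom → ℝ
  outer_measurable : Measurable outer
  eq_outer : ∀ s : ∀ k, S k, f s = outer ⟨∑ k, inner k (s k), sum_mem s⟩

namespace NomographicRep

variable {K : ℕ} {S : Fin K → Set ℝ} {f : (∀ k, S k) → ℝ}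

/-- `Φ : [0, ∞) → [0, ∞)` is strictly increasing, vanishes at `0` and dominates the increments of
the outer function. (Only the values of `Φ` on `[0, ∞)` matter; they are nonnegative.) -/
def IsIncrementMajorant (r : NomographicRep S f) (Φ : ℝ → ℝ) : Prop :=
  StrictMonoOn Φ (Set.Ici 0) ∧ Φ 0 = 0 ∧
    ∀ x y : r.dom, |r.outer x - r.outer y| ≤ Φ |(x : ℝ) - y|

/-- `φ_{min,k}` -/
noncomputable def phiMin (r : NomographicRep S f) (k : Fin K) : ℝ := ⨅ s, r.inner k s

/-- `φ_{max,k}` -/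
noncomputable def phiMax (r : NomographicRep S f) (k : Fin K) : ℝ := ⨆ s, r.inner k s

/-- The total spread. -/
noncomputable def totalSpread (r : NomographicRep S f) : ℝ := ∑ k, (r.phiMax k - r.phiMin k)

/-- The max-spread. -/
noncomputable def maxSpread (r : NomographicRep S f) : ℝ := ⨆ k, (r.phiMax k - r.phiMin k)

end NomographicRep

/-- The inverse of an increasing function `Φ` on `[0, ∞)`. It is the usual inverse at every `ε` in
the range of `Φ`; at an `ε` which `Φ` jumps over it is the place of the jump. -/
noncomputable def majorantInv (Φ : ℝ → ℝ) (ε : ℝ) : ℝ := sInf {t : ℝ | 0 ≤ t ∧ ε ≤ Φ t}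

/-! ### The channel -/

/-- Index set of the real fading coefficients: `(m, 0, k)` is the real part and `(m, 1, k)` the
imaginary part of the coefficient of user `k` at channel use `m`. -/
abbrev FadingIdx (K M : ℕ) := Fin M × Fin 2 × Fin K

/-- Index set of the real noise variables: `(m, 0)` is the real and `(m, 1)` the imaginary part. -/
abbrev NoiseIdx (M : ℕ) := Fin M × Fin 2

/-- Index set of the underlying independent random variables. -/
abbrev SourceIdx (K M : ℕ) := Fin (2 * K * M + 2 * M)

/-- The random vector `A R`. -/
def mixed {ι κ Ω : Type*} [Fintype κ] (A : Matrix ι κ ℝ) (R : κ → Ω → ℝ) (i : ι) (ω : Ω) : ℝ :=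
  (A *ᵥ fun j => R j ω) i

/-- Any two different users have independent fading in the same complex dimension of the same
channel use. -/
def UserUncorrelated {K M : ℕ} {Ω : Type*} [MeasurableSpace Ω] (H : FadingIdx K M → Ω → ℝ)
    (μ : Measure Ω) : Prop :=
  ∀ (m : Fin M) (j : Fin 2) (k₁ k₂ : Fin K), k₁ ≠ k₂ →
    IndepFun (H (m, j, k₁)) (H (m, j, k₂)) μ

/-- The correlated sub-Gaussian model: the fading vector is `A R` and the noise vector is `B R`,
where the `R j` are independent with sub-Gaussian norm at most `1`; all the fading coefficients
have mean zero and variance one, and the noise variables have mean zero. -/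
structure IsCorrelatedChannel {K M : ℕ} {Ω : Type*} [MeasurableSpace Ω] (μ : Measure Ω)
    (R : SourceIdx K M → Ω → ℝ) (A : Matrix (FadingIdx K M) (SourceIdx K M) ℝ)
    (B : Matrix (NoiseIdx M) (SourceIdx K M) ℝ) : Prop where
  measurable : ∀ j, Measurable (R j)
  indep : iIndepFun R μ
  subGauss : ∀ j, subGaussNorm (R j) μ ≤ 1
  fading_mean : ∀ i, μ[mixed A R i] = 0
  fading_variance : ∀ i, Var[mixed A R i; μ] = 1
  noise_mean : ∀ i, μ[mixed B R i] = 0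

/-- Complex fading coefficient `H_k(m)`. -/
noncomputable def fading {K M : ℕ} {Ω : Type*} (A : Matrix (FadingIdx K M) (SourceIdx K M) ℝ)
    (R : SourceIdx K M → Ω → ℝ) (k : Fin K) (m : Fin M) (ω : Ω) : ℂ :=
  ⟨mixed A R (m, 0, k) ω, mixed A R (m, 1, k) ω⟩

/-- Complex noise `N(m)`. -/
noncomputable def noise {K M : ℕ} {Ω : Type*} (B : Matrix (NoiseIdx M) (SourceIdx K M) ℝ)
    (R : SourceIdx K M → Ω → ℝ) (m : Fin M) (ω : Ω) : ℂ :=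
  ⟨mixed B R (m, 0) ω, mixed B R (m, 1) ω⟩

/-- Channel output `Y(m) = ∑ₖ H_k(m) x_k(m) + N(m)`, for `m = 1, …, M`. -/
noncomputable def channelOutput {K M : ℕ} {Ω : Type*}
    (A : Matrix (FadingIdx K M) (SourceIdx K M) ℝ) (B : Matrix (NoiseIdx M) (SourceIdx K M) ℝ)
    (R : SourceIdx K M → Ω → ℝ) (x : Fin K → Fin M → ℂ) (ω : Ω) : Fin M → ℂ :=
  fun m => ∑ k, fading A R k m ω * x k m + noise B R m ω

/-- Expected total noise energy `E ‖N‖²`. -/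
noncomputable def noiseEnergy {K M : ℕ} {Ω : Type*} [MeasurableSpace Ω] (μ : Measure Ω)
    (B : Matrix (NoiseIdx M) (SourceIdx K M) ℝ) (R : SourceIdx K M → Ω → ℝ) : ℝ :=
  ∫ ω, ∑ m, ‖noise B R m ω‖ ^ 2 ∂μ

/-! ### Distributed approximation schemes -/

/-- An admissible scheme with `M` channel uses and peak power `P`: a joint law of the encoders'
randomness `U_k(m)` (with values in `T`), measurable encoders that obey the power constraint, and a
measurable decoder. -/
structure DFAScheme {K : ℕ} (S : Fin K → Set ℝ) (M : ℕ) (P : ℝ) (T : Type)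
    [MeasurableSpace T] where
  law : Measure (Fin K → Fin M → T)
  isProbabilityMeasure_law : IsProbabilityMeasure law
  enc : ∀ k, Fin M → S k → T → ℂ
  enc_measurable : ∀ k, Measurable fun p : S k × (Fin M → T) => fun m => enc k m p.1 (p.2 m)
  enc_power : ∀ k m s t, ‖enc k m s t‖ ^ 2 ≤ P
  dec : (Fin M → ℂ) → ℝ
  dec_measurable : Measurable dec

/-- The receiver's estimate for the input `s`, as a random variable of the channel randomness `ω`
and the encoder randomness `u`. -/
noncomputable def DFAScheme.estimate {K M : ℕ} {S : Fin K → Set ℝ} {P : ℝ} {T : Type}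
    [MeasurableSpace T] (σ : DFAScheme S M P T) {Ω : Type*}
    (A : Matrix (FadingIdx K M) (SourceIdx K M) ℝ) (B : Matrix (NoiseIdx M) (SourceIdx K M) ℝ)
    (R : SourceIdx K M → Ω → ℝ) (s : ∀ k, S k) (p : Ω × (Fin K → Fin M → T)) : ℝ :=
  σ.dec (channelOutput A B R (fun k m => σ.enc k m (s k) (p.2 k m)) p.1)

/-- The sign encoded by a bit. -/
def bitSign (b : Bool) : ℝ := if b then 1 else -1

namespace NomographicRep

variable {K : ℕ} {S : Fin K → Set ℝ} {f : (∀ k, S k) → ℝ}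

/-- Transmit power `a_k = P / Δ(f) * (f_k(s) - φ_{min,k})` of user `k` for the input `s`. -/
noncomputable def power (r : NomographicRep S f) (P : ℝ) (k : Fin K) (s : S k) : ℝ :=
  P / r.maxSpread * (r.inner k s - r.phiMin k)

theorem power_le (r : NomographicRep S f) {P : ℝ} (hP : 0 ≤ P) (k : Fin K) (s : S k) :
    0 ≤ r.power P k s ∧ r.power P k s ≤ P := by
  obtain ⟨C, hC⟩ := r.inner_bounded k
  have h1 : r.phiMin k ≤ r.inner k s :=
    ciInf_le ⟨-C, by rintro _ ⟨s, rfl⟩; exact (abs_le.1 (hC s)).1⟩ s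
  have h2 : r.inner k s ≤ r.phiMax k :=
    le_ciSup ⟨C, by rintro _ ⟨s, rfl⟩; exact (abs_le.1 (hC s)).2⟩ s
  have h3 : r.phiMax k - r.phiMin k ≤ r.maxSpread :=
    le_ciSup (f := fun k => r.phiMax k - r.phiMin k) (Set.finite_range _).bddAbove k
  have h4 : 0 ≤ r.maxSpread := by linarith
  refine ⟨mul_nonneg (div_nonneg hP h4) (by linarith), ?_⟩
  calc r.power P k s ≤ P / r.maxSpread * r.maxSpread :=
        mul_le_mul_of_nonneg_left (by linarith) (div_nonneg hP h4)
    _ = P * (r.maxSpread / r.maxSpread) := by ring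
    _ ≤ P := mul_le_of_le_one_right hP (div_self_le_one _)

/-- `ḡ(t) = Δ(f) / (2 M P) * t + ∑ₖ φ_{min,k}` -/
noncomputable def rescale (r : NomographicRep S f) (M : ℕ) (P t : ℝ) : ℝ :=
  r.maxSpread / (2 * M * P) * t + ∑ k, r.phiMin k

/-- The random-sign power-encoding / receive-energy decoding scheme. User `k` sends
`√a_k U_k(m)` with independent uniform signs `U_k(m)`; the receiver subtracts the expected noise
energy `E` from the receive energy, rescales, and applies `G`, an extension of the outer function
to `ℝ`. -/
noncomputable def energyScheme (r : NomographicRep S f) (G : ℝ → ℝ) (hG : Measurable G) (M : ℕ)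
    (P : ℝ) (hP : 0 < P) (E : ℝ) : DFAScheme S M P Bool where
  law := Measure.pi fun _ => Measure.pi fun _ => (PMF.uniformOfFintype Bool).toMeasure
  isProbabilityMeasure_law := inferInstance
  enc k _ s b := ((√(r.power P k s) * bitSign b : ℝ) : ℂ)
  enc_measurable k := by
    have hb : Measurable bitSign := measurable_of_finite _
    have hi := r.inner_measurable k
    unfold power
    fun_prop
  enc_power k m s b := by
    obtain ⟨h0, h1⟩ := r.power_le hP.le k s
    rw [Complex.norm_real, Real.norm_eq_abs, sq_abs, mul_pow, Real.sq_sqrt h0]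
    cases b <;> simpa [bitSign] using h1
  dec y := G (r.rescale M P (∑ m, ‖y m‖ ^ 2 - E))
  dec_measurable := by
    unfold rescale
    fun_prop

end NomographicRep

/-! ### The constants of the error bound -/

section Constants

variable {K M : ℕ} {S : Fin K → Set ℝ} {f : (∀ k, S k) → ℝ}

/-- `L = (√Δ̄ ‖A‖_op + √(Δ/P) ‖B‖_op)²` -/
noncomputable def constL (r : NomographicRep S f) (P : ℝ)
    (A : Matrix (FadingIdx K M) (SourceIdx K M) ℝ)
    (B : Matrix (NoiseIdx M) (SourceIdx K M) ℝ) : ℝ :=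
  (√r.totalSpread * opNorm A + √(r.maxSpread / P) * opNorm B) ^ 2

/-- `F = L (√(Δ̄/M) ‖A‖_F + √(Δ/(P M)) ‖B‖_F)²` -/
noncomputable def constF (r : NomographicRep S f) (P : ℝ)
    (A : Matrix (FadingIdx K M) (SourceIdx K M) ℝ)
    (B : Matrix (NoiseIdx M) (SourceIdx K M) ℝ) : ℝ :=
  constL r P A B *
    (√(r.totalSpread / M) * frobNorm A + √(r.maxSpread / (P * M)) * frobNorm B) ^ 2

/-- `D = (4 √(2M) Δ̄ η + 4 Δ / √(P M) ‖A Bᵀ‖_F)²` -/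
noncomputable def constD (r : NomographicRep S f) (P η : ℝ)
    (A : Matrix (FadingIdx K M) (SourceIdx K M) ℝ)
    (B : Matrix (NoiseIdx M) (SourceIdx K M) ℝ) : ℝ :=
  (4 * √(2 * M) * r.totalSpread * η
    + 4 * (r.maxSpread / √(P * M)) * frobNorm (A * Bᵀ)) ^ 2

end Constants

/-!
The second exponential alone bounds the error probability. Correlations between the users let the
random signs influence the receive energy, but the constants `L` and `F`, which hold the norms of
the full mixing matrices, control this influence as well.

*Reduction to the receive energy.* `exists_measurable_extension` extends the outer function by a
measurable `G` with `|G x - F y| ≤ Φ (2 |x - y| + δ)` for all `y` in the domain of `F` and all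
`δ > 0`. Hence an error of at least `ε` forces the argument of `G` to deviate from the true sum by
at least `τ = Φ⁻¹(ε) / 2`. With the sources centred, the channel output is the image of the source
vector `X` under a matrix `C` that depends on the random signs (`receiveMatrix`), and the deviation
is a multiple of `|C X|² - E |C X|²`.

*Exponential moments.* Given the signs, `|C X|² - E[|C X|² | signs]` is a centred quadratic form in
independent sub-Gaussian variables, and the Hanson-Wright bound
`lintegral_exp_sum_mulVec_sq_sub_le` applies. It depends on the signs only through the operator and
Frobenius norms of `C`, which are bounded uniformly. The remaining term `E[|C X|² | signs]` is a
quadratic polynomial in the signs with constant diagonal (`energy_eq`); its off-diagonal and linear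
coefficients are entries of Gram matrices of the rows of `A` and `B`
(`opNorm_fadingGram_le`, `frobNorm_fadingGram_le`, `frobNorm_fadingNoiseGram_le`).

Both terms rest on one estimate for off-diagonal quadratic polynomials, `lintegral_exp_chaos_le`.
Such a polynomial is four times the average of its cross parts between a set `I` of coordinates and
the complement of `I` (`sum_crossPart`). In a cross part one averages over the coordinates in `I`
first, and the resulting exponential of a squared norm is linearized by a Gaussian vector in an
eigenbasis (`lintegral_exp_sum_sq_le`).

*Tail.* The two bounds add up to `E exp (t (|C X|² - E |C X|²)) ≤ exp (64 t² ℓ² r²)` for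
`16 |t| ℓ² ≤ 1`, where `ℓ` and `r` bound the operator and the Frobenius norm of `C`
(`lintegral_exp_receive_le`). Chernoff's bound at `τ` is then the second exponential; the loss of
the factor `2` in `τ` is covered by its constants.
-/

/-! ### Operator and Frobenius norms of real matrices -/

section MatrixNorms

variable {l m n p : Type*} [Fintype l] [Fintype m] [Fintype n] [Fintype p]

theorem opNorm_nonneg [DecidableEq n] (A : Matrix m n ℝ) : 0 ≤ opNorm A := norm_nonneg _

theorem sum_mulVec_sq_le [DecidableEq n] (A : Matrix m n ℝ) (x : n → ℝ) :
    ∑ i, (A *ᵥ x) i ^ 2 ≤ opNorm A ^ 2 * ∑ j, x j ^ 2 := by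
  have h := (LinearMap.toContinuousLinearMap (Matrix.toEuclideanLin A)).le_opNorm (WithLp.toLp 2 x)
  have h2 := pow_le_pow_left₀ (norm_nonneg _) h 2
  rw [mul_pow, EuclideanSpace.norm_sq_eq, EuclideanSpace.norm_sq_eq] at h2
  simpa [opNorm] using h2

theorem opNorm_le [DecidableEq n] {A : Matrix m n ℝ} {c : ℝ} (hc : 0 ≤ c)
    (h : ∀ x : n → ℝ, ∑ i, (A *ᵥ x) i ^ 2 ≤ c ^ 2 * ∑ j, x j ^ 2) : opNorm A ≤ c := by
  refine ContinuousLinearMap.opNorm_le_bound _ hc fun x => ?_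
  refine (sq_le_sq₀ (norm_nonneg _) (by positivity)).1 ?_
  rw [mul_pow, EuclideanSpace.norm_sq_eq, EuclideanSpace.norm_sq_eq]
  simpa using h x.ofLp

theorem opNorm_add_le [DecidableEq n] (A B : Matrix m n ℝ) :
    opNorm (A + B) ≤ opNorm A + opNorm B := by
  simpa [opNorm] using norm_add_le (LinearMap.toContinuousLinearMap (Matrix.toEuclideanLin A))
    (LinearMap.toContinuousLinearMap (Matrix.toEuclideanLin B))

theorem opNorm_mul_le [DecidableEq m] [DecidableEq n] (A : Matrix l m ℝ) (B : Matrix m n ℝ) :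
    opNorm (A * B) ≤ opNorm A * opNorm B := by
  refine opNorm_le (mul_nonneg (opNorm_nonneg _) (opNorm_nonneg _)) fun x => ?_
  rw [← Matrix.mulVec_mulVec, mul_pow, mul_assoc]
  exact (sum_mulVec_sq_le A _).trans
    (mul_le_mul_of_nonneg_left (sum_mulVec_sq_le B x) (sq_nonneg _))

theorem opNorm_transpose_le [DecidableEq m] [DecidableEq n] (A : Matrix m n ℝ) :
    opNorm Aᵀ ≤ opNorm A := by
  refine opNorm_le (opNorm_nonneg _) fun x => ?_
  set y := Aᵀ *ᵥ x with hy
  set S := ∑ i, y i ^ 2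
  have hS : 0 ≤ S := Finset.sum_nonneg fun i _ => sq_nonneg _
  -- `|Aᵀx|² = ⟨x, A Aᵀ x⟩`
  have h1 : S = ∑ i, x i * (A *ᵥ y) i := by
    have : y ⬝ᵥ y = x ⬝ᵥ (A *ᵥ y) := by
      rw [Matrix.dotProduct_mulVec x A y, ← Matrix.mulVec_transpose]
    simpa [dotProduct, S, sq] using this
  have h2 := Finset.sum_mul_sq_le_sq_mul_sq Finset.univ x (A *ᵥ y)
  rw [← h1] at h2
  have hx : 0 ≤ ∑ i, x i ^ 2 := Finset.sum_nonneg fun i _ => sq_nonneg _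
  have h3 := mul_le_mul_of_nonneg_left (sum_mulVec_sq_le A y) hx
  rcases hS.eq_or_lt with h0 | h0
  · rw [← h0]; positivity
  · have : S * S ≤ (opNorm A ^ 2 * ∑ i, x i ^ 2) * S := by
      calc S * S = S ^ 2 := by ring
        _ ≤ _ := h2.trans h3
        _ = _ := by ring
    exact le_of_mul_le_mul_right this h0

theorem opNorm_transpose [DecidableEq m] [DecidableEq n] (A : Matrix m n ℝ) :
    opNorm Aᵀ = opNorm A :=
  le_antisymm (opNorm_transpose_le A) (by simpa using opNorm_transpose_le Aᵀ)

theorem opNorm_diagonal_le [DecidableEq n] {d : n → ℝ} {c : ℝ} (hc : 0 ≤ c) (h : ∀ i, |d i| ≤ c) :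
    opNorm (Matrix.diagonal d) ≤ c := by
  refine opNorm_le hc fun x => ?_
  rw [Finset.mul_sum]
  refine Finset.sum_le_sum fun i _ => ?_
  rw [Matrix.mulVec_diagonal, mul_pow, ← sq_abs (d i)]
  gcongr
  exact h i

theorem opNorm_submatrix_le [DecidableEq n] [DecidableEq p] (A : Matrix m n ℝ)
    {e : l → m} {g : p → n} (he : e.Injective) (hg : g.Injective) :
    opNorm (A.submatrix e g) ≤ opNorm A := by
  classical
  refine opNorm_le (opNorm_nonneg _) fun x => ?_
  have h := sum_mulVec_sq_le A (Function.extend g x 0)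
  have h1 : ∑ j, Function.extend g x 0 j ^ 2 = ∑ j, x j ^ 2 := by
    rw [← Finset.sum_subset (Finset.subset_univ (Finset.univ.image g)),
      Finset.sum_image (fun a _ b _ h => hg h)]
    · simp [hg.extend_apply]
    · intro j _ hj
      rw [Function.extend_apply' _ _ _ (by simpa using hj)]; simp
  have h2 : ∀ i, (A *ᵥ Function.extend g x 0) (e i) = (A.submatrix e g *ᵥ x) i := by
    intro i
    simp only [Matrix.mulVec, dotProduct, Matrix.submatrix_apply]
    rw [← Finset.sum_subset (Finset.subset_univ (Finset.univ.image g)),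
      Finset.sum_image (fun a _ b _ h => hg h)]
    · simp [hg.extend_apply]
    · intro j _ hj
      rw [Function.extend_apply' _ _ _ (by simpa using hj)]; simp
  rw [h1] at h
  refine le_trans ?_ h
  simp_rw [← h2]
  rw [← Finset.sum_image (f := fun i => (A *ᵥ Function.extend g x 0) i ^ 2)
    (fun a _ b _ h => he h)]
  exact Finset.sum_le_sum_of_subset_of_nonneg (Finset.subset_univ _) fun i _ _ => sq_nonneg _

theorem sum_col_sq_le [DecidableEq n] (A : Matrix m n ℝ) (j : n) :
    ∑ i, A i j ^ 2 ≤ opNorm A ^ 2 := by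
  have h := sum_mulVec_sq_le A (Pi.single j 1)
  have : ∑ k, (Pi.single j 1 : n → ℝ) k ^ 2 = 1 := by
    rw [Finset.sum_eq_single j] <;> simp +contextual
  simpa [this] using h

theorem frobNorm_sq (A : Matrix m n ℝ) : frobNorm A ^ 2 = ∑ i, ∑ j, A i j ^ 2 :=
  Real.sq_sqrt (Finset.sum_nonneg fun _ _ => Finset.sum_nonneg fun _ _ => sq_nonneg _)

theorem frobNorm_nonneg (A : Matrix m n ℝ) : 0 ≤ frobNorm A := Real.sqrt_nonneg _

theorem frobNorm_transpose (A : Matrix m n ℝ) : frobNorm Aᵀ = frobNorm A := by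
  unfold frobNorm
  rw [Finset.sum_comm]
  rfl

/-- The Frobenius norm is the Euclidean norm of the vector of all entries. -/
theorem frobNorm_eq_norm (A : Matrix m n ℝ) :
    frobNorm A = ‖(WithLp.toLp 2 fun q : m × n => A q.1 q.2 : EuclideanSpace ℝ (m × n))‖ := by
  rw [EuclideanSpace.norm_eq, frobNorm, Fintype.sum_prod_type]
  simp

theorem frobNorm_add_le (A B : Matrix m n ℝ) : frobNorm (A + B) ≤ frobNorm A + frobNorm B := by
  rw [frobNorm_eq_norm A, frobNorm_eq_norm B, frobNorm_eq_norm (A + B)]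
  refine le_of_eq_of_le (congrArg norm ?_) (norm_add_le _ _)
  ext q
  rfl

theorem frobNorm_mul_le [DecidableEq m] (A : Matrix l m ℝ) (B : Matrix m n ℝ) :
    frobNorm (A * B) ≤ opNorm A * frobNorm B := by
  refine (sq_le_sq₀ (frobNorm_nonneg _) (mul_nonneg (opNorm_nonneg _) (frobNorm_nonneg _))).1 ?_
  rw [mul_pow, frobNorm_sq, frobNorm_sq, Finset.sum_comm, Finset.sum_comm (γ := m), Finset.mul_sum]
  refine Finset.sum_le_sum fun j _ => ?_
  simpa [Matrix.mul_apply, Matrix.mulVec, dotProduct] using sum_mulVec_sq_le A fun k => B k j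

end MatrixNorms

/-! ### Exponential moments of squared norms -/

section Gaussian

/-- Exponential moments of a quadratic polynomial of a standard Gaussian, by completing the
square. -/
theorem lintegral_exp_quadratic_gaussianReal {a : ℝ} (ha : a < 1 / 2) (b : ℝ) :
    ∫⁻ g, ENNReal.ofReal (Real.exp (a * g ^ 2 + b * g)) ∂gaussianReal 0 1
      = ENNReal.ofReal ((√(1 - 2 * a))⁻¹ * Real.exp (b ^ 2 / (2 * (1 - 2 * a)))) := by
  have h0 : 0 < 1 - 2 * a := by linarith
  set v : ℝ≥0 := ⟨(1 - 2 * a)⁻¹, by positivity⟩ with hv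
  have hvr : (v : ℝ) = (1 - 2 * a)⁻¹ := rfl
  have hv0 : v ≠ 0 := by
    intro h
    have : (v : ℝ) = 0 := by rw [h]; rfl
    rw [hvr] at this
    exact (inv_pos.2 h0).ne' this
  rw [gaussianReal_of_var_ne_zero 0 one_ne_zero,
    lintegral_withDensity_eq_lintegral_mul _ (measurable_gaussianPDF 0 1) (by fun_prop)]
  have key : ∀ g : ℝ, (gaussianPDF 0 1 * fun g => ENNReal.ofReal (Real.exp (a * g ^ 2 + b * g))) g
      = ENNReal.ofReal ((√(1 - 2 * a))⁻¹ * Real.exp (b ^ 2 / (2 * (1 - 2 * a))))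
        * gaussianPDF (b / (1 - 2 * a)) v g := by
    intro g
    rw [Pi.mul_apply, gaussianPDF, gaussianPDF, ← ENNReal.ofReal_mul (gaussianPDFReal_nonneg _ _ _),
      ← ENNReal.ofReal_mul (by positivity)]
    congr 1
    simp only [gaussianPDFReal, hvr]
    have e1 : (√(2 * Real.pi * (1 - 2 * a)⁻¹))⁻¹ = (√(2 * Real.pi))⁻¹ * √(1 - 2 * a) := by
      rw [Real.sqrt_mul (by positivity), Real.sqrt_inv, mul_inv, inv_inv]
    have e2 : √(1 - 2 * a) ≠ 0 := (Real.sqrt_pos.2 h0).ne'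
    rw [e1]
    have e3 : Real.exp (-(g - 0) ^ 2 / (2 * ((1 : ℝ≥0) : ℝ))) * Real.exp (a * g ^ 2 + b * g)
        = Real.exp (b ^ 2 / (2 * (1 - 2 * a)))
          * Real.exp (-(g - b / (1 - 2 * a)) ^ 2 / (2 * (1 - 2 * a)⁻¹)) := by
      rw [← Real.exp_add, ← Real.exp_add]
      congr 1
      have := h0.ne'
      push_cast
      field_simp
      ring
    calc _ = (√(2 * Real.pi))⁻¹ * (Real.exp (-(g - 0) ^ 2 / (2 * ((1 : ℝ≥0) : ℝ)))
          * Real.exp (a * g ^ 2 + b * g)) := by push_cast; ring_nf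
      _ = _ := by
        rw [e3]
        field_simp
  rw [lintegral_congr key, lintegral_const_mul _ (measurable_gaussianPDF _ _),
    lintegral_gaussianPDF_eq_one _ hv0, mul_one]

theorem lintegral_exp_mul_gaussianReal (b : ℝ) :
    ∫⁻ g, ENNReal.ofReal (Real.exp (b * g)) ∂gaussianReal 0 1
      = ENNReal.ofReal (Real.exp (b ^ 2 / 2)) := by
  simpa using lintegral_exp_quadratic_gaussianReal (a := 0) (by norm_num) b

theorem lintegral_exp_quadratic_gaussianReal_le {a : ℝ} (ha0 : 0 ≤ a) (ha : a ≤ 1 / 8) (b : ℝ) :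
    ∫⁻ g, ENNReal.ofReal (Real.exp (a * g ^ 2 + b * g)) ∂gaussianReal 0 1
      ≤ ENNReal.ofReal (Real.exp (4 / 3 * (a + b ^ 2 / 2))) := by
  rw [lintegral_exp_quadratic_gaussianReal (by linarith)]
  refine ENNReal.ofReal_le_ofReal ?_
  have h0 : 0 < 1 - 2 * a := by linarith
  have h1 : (√(1 - 2 * a))⁻¹ ≤ Real.exp (4 / 3 * a) := by
    rw [inv_le_comm₀ (Real.sqrt_pos.2 h0) (Real.exp_pos _), ← Real.exp_neg]
    refine Real.le_sqrt_of_sq_le ?_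
    rw [← Real.exp_nat_mul]
    have h2 := Real.add_one_le_exp (8 / 3 * a)
    have h3 : Real.exp ((2 : ℕ) * -(4 / 3 * a)) * Real.exp (8 / 3 * a) = 1 := by
      rw [← Real.exp_add]; simp; ring
    have h4 := Real.exp_pos ((2 : ℕ) * -(4 / 3 * a))
    have h5 : 1 ≤ (1 - 2 * a) * Real.exp (8 / 3 * a) :=
      le_trans (by nlinarith) (mul_le_mul_of_nonneg_left h2 h0.le)
    have h6 := Real.exp_pos (8 / 3 * a)
    by_contra hlt
    push Not at hlt
    nlinarith
  have h2 : b ^ 2 / (2 * (1 - 2 * a)) ≤ 4 / 3 * (b ^ 2 / 2) := by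
    rw [div_le_iff₀ (by positivity)]
    nlinarith [sq_nonneg b]
  rw [mul_add, Real.exp_add]
  exact mul_le_mul h1 (Real.exp_le_exp.2 h2) (Real.exp_pos _).le (Real.exp_pos _).le

end Gaussian

section SubGaussianChaos

variable {Ω : Type*} [MeasurableSpace Ω] {μ : Measure Ω}

theorem lintegral_ofReal_exp {X : Ω → ℝ} (h : Integrable (fun ω => Real.exp (X ω)) μ) :
    ∫⁻ ω, ENNReal.ofReal (Real.exp (X ω)) ∂μ = ENNReal.ofReal (∫ ω, Real.exp (X ω) ∂μ) :=
  (ofReal_integral_eq_lintegral_ofReal h (ae_of_all _ fun _ => (Real.exp_pos _).le)).symm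

theorem lintegral_exp_dotProduct_le {κ : Type*} [Fintype κ] {X : κ → Ω → ℝ}
    (hind : iIndepFun X μ) (hX : ∀ j, HasSubgaussianMGF (X j) 1 μ) (c : κ → ℝ) :
    ∫⁻ ω, ENNReal.ofReal (Real.exp (∑ j, c j * X j ω)) ∂μ
      ≤ ENNReal.ofReal (Real.exp ((∑ j, c j ^ 2) / 2)) := by
  have h1 : iIndepFun (fun j ω => c j * X j ω) μ :=
    hind.comp (fun j x => c j * x) fun j => by fun_prop
  have h2 := HasSubgaussianMGF.sum_of_iIndepFun h1 (s := Finset.univ)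
    fun j _ => (hX j).const_mul (c j)
  have h3 := h2.integrable_exp_mul 1
  have h4 := h2.mgf_le 1
  simp only [one_mul] at h3
  rw [lintegral_ofReal_exp h3]
  refine ENNReal.ofReal_le_ofReal ?_
  have h5 : ((∑ j, (⟨c j ^ 2, sq_nonneg _⟩ * 1 : ℝ≥0) : ℝ≥0) : ℝ) = ∑ j, c j ^ 2 := by
    rw [NNReal.coe_sum]
    exact Finset.sum_congr rfl fun j _ => mul_one (c j ^ 2)
  rw [h5] at h4
  simpa [mgf] using h4

/-- An orthonormal eigenbasis `u` of `D Dᵀ` with eigenvalues `s`: its coordinates preserve the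
Euclidean norm, the quadratic form `|Dᵀ w|²` is diagonal in it, and the eigenvalues are bounded by
`opNorm D ^ 2` and sum up to `frobNorm D ^ 2`. -/
theorem exists_orthonormal_diag {m κ : Type*} [Fintype m] [Fintype κ] [DecidableEq m]
    [DecidableEq κ] (D : Matrix m κ ℝ) :
    ∃ (u : m → m → ℝ) (s : m → ℝ),
      (∀ y : m → ℝ, ∑ i, (u i ⬝ᵥ y) ^ 2 = ∑ i, y i ^ 2) ∧
      (∀ g : m → ℝ, ∑ k, (∑ i, g i * (u i ᵥ* D) k) ^ 2 = ∑ i, s i * g i ^ 2) ∧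
      (∀ i, 0 ≤ s i ∧ s i ≤ opNorm D ^ 2) ∧ ∑ i, s i = frobNorm D ^ 2 := by
  have hH : (D * Dᵀ).IsHermitian := by
    simpa using Matrix.isHermitian_mul_conjTranspose_self D
  have hpar : ∀ y : m → ℝ, ∑ i, ((hH.eigenvectorBasis i).ofLp ⬝ᵥ y) ^ 2 = ∑ i, y i ^ 2 := by
    intro y
    have h := hH.eigenvectorBasis.sum_sq_norm_inner_right (WithLp.toLp 2 y)
    rw [EuclideanSpace.norm_sq_eq] at h
    simpa [EuclideanSpace.inner_eq_star_dotProduct, dotProduct_comm] using h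
  have horth : ∀ i j, (hH.eigenvectorBasis i).ofLp ⬝ᵥ (hH.eigenvectorBasis j).ofLp
      = if i = j then 1 else 0 := by
    intro i j
    have h := orthonormal_iff_ite.1 hH.eigenvectorBasis.orthonormal i j
    simpa [EuclideanSpace.inner_eq_star_dotProduct, dotProduct_comm] using h
  have hgram : ∀ i j, ((hH.eigenvectorBasis i).ofLp ᵥ* D) ⬝ᵥ ((hH.eigenvectorBasis j).ofLp ᵥ* D)
      = if i = j then hH.eigenvalues j else 0 := by
    intro i j
    rw [← Matrix.mulVec_transpose D (hH.eigenvectorBasis j).ofLp, ← Matrix.dotProduct_mulVec,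
      Matrix.mulVec_mulVec, hH.mulVec_eigenvectorBasis, dotProduct_smul, horth]
    simp
  refine ⟨fun i => (hH.eigenvectorBasis i).ofLp, hH.eigenvalues, hpar, ?_, ?_, ?_⟩
  · intro g
    have : ∀ k, (∑ i, g i * ((hH.eigenvectorBasis i).ofLp ᵥ* D) k)
        = (∑ i, g i • ((hH.eigenvectorBasis i).ofLp ᵥ* D)) k := by
      intro k; simp [Finset.sum_apply]
    simp_rw [this]
    have h2 : ∀ x : κ → ℝ, ∑ k, x k ^ 2 = x ⬝ᵥ x := fun x => by simp [dotProduct, sq]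
    rw [h2, sum_dotProduct]
    simp_rw [dotProduct_sum, smul_dotProduct, dotProduct_smul, hgram]
    simp
    exact Finset.sum_congr rfl fun i _ => by ring
  · intro i
    have h1 := hgram i i
    rw [if_pos rfl] at h1
    have h2 := sum_mulVec_sq_le Dᵀ (hH.eigenvectorBasis i).ofLp
    rw [opNorm_transpose, Matrix.mulVec_transpose] at h2
    have h3 := horth i i
    rw [if_pos rfl] at h3
    simp only [dotProduct, ← sq] at h1 h3
    rw [h1, h3, mul_one] at h2
    exact ⟨by rw [← h1]; positivity, h2⟩
  · have h := hH.trace_eq_sum_eigenvalues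
    simp only [RCLike.ofReal_real_eq_id, id] at h
    rw [← h, frobNorm_sq]
    simp [Matrix.trace, Matrix.mul_apply, sq]

theorem lintegral_pi_prod {m : Type*} [Fintype m] (ν : Measure ℝ) [IsProbabilityMeasure ν]
    (f : m → ℝ → ℝ≥0∞) (hf : ∀ i, Measurable (f i)) :
    ∫⁻ g, ∏ i, f i (g i) ∂Measure.pi (fun _ : m => ν) = ∏ i, ∫⁻ x, f i x ∂ν := by
  have h : iIndepFun (fun i (g : m → ℝ) => f i (g i)) (Measure.pi fun _ : m => ν) :=
    iIndepFun_pi (X := f) fun i => (hf i).aemeasurable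
  rw [lintegral_prod_eq_prod_lintegral_of_indepFun Finset.univ _ h fun i =>
    (hf i).comp (measurable_pi_apply i)]
  refine Finset.prod_congr rfl fun i _ => ?_
  rw [← (measurePreserving_eval (fun _ : m => ν) i).lintegral_comp (hf i)]

theorem ofReal_exp_sum {m : Type*} (s : Finset m) (f : m → ℝ) :
    ENNReal.ofReal (Real.exp (∑ i ∈ s, f i)) = ∏ i ∈ s, ENNReal.ofReal (Real.exp (f i)) := by
  rw [Real.exp_sum, ENNReal.ofReal_prod_of_nonneg fun i _ => (Real.exp_pos _).le]

/-- Exponential moments of the squared norm of an affine image of an independent sub-Gaussian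
vector. The square is linearized by an auxiliary standard Gaussian vector `g`, written in an
eigenbasis of `D Dᵀ`; averaging over `X` first leaves a diagonal quadratic form in `g`. -/
theorem lintegral_exp_sum_sq_le {m κ : Type*} [Fintype m] [Fintype κ] [DecidableEq κ]
    {X : κ → Ω → ℝ} (hm : ∀ j, Measurable (X j))
    (hind : iIndepFun X μ) (hX : ∀ j, HasSubgaussianMGF (X j) 1 μ)
    (D : Matrix m κ ℝ) (b : m → ℝ) {θ : ℝ} (hθ : 0 ≤ θ) (hD : 8 * θ * opNorm D ^ 2 ≤ 1) :
    ∫⁻ ω, ENNReal.ofReal (Real.exp (θ * ∑ i, ((D *ᵥ fun j => X j ω) i + b i) ^ 2)) ∂μ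
      ≤ ENNReal.ofReal (Real.exp (4 / 3 * θ * (frobNorm D ^ 2 + ∑ i, b i ^ 2))) := by
  classical
  have : IsProbabilityMeasure μ := hind.isProbabilityMeasure
  obtain ⟨u, s, hpar, hgram, hs, htr⟩ := exists_orthonormal_diag D
  set t : ℝ := √(2 * θ) with ht
  have ht2 : t ^ 2 = 2 * θ := Real.sq_sqrt (by positivity)
  set γ : Measure (m → ℝ) := Measure.pi fun _ : m => gaussianReal 0 1 with hγ
  set y : Ω → m → ℝ := fun ω => (D *ᵥ fun j => X j ω) + b with hy
  have hym : ∀ i, Measurable fun ω => u i ⬝ᵥ y ω := by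
    intro i
    simp only [hy, Matrix.mulVec, dotProduct, Pi.add_apply]
    fun_prop
  have h1 : ∀ ω, ENNReal.ofReal (Real.exp (θ * ∑ i, ((D *ᵥ fun j => X j ω) i + b i) ^ 2))
      = ∫⁻ g, ENNReal.ofReal (Real.exp (∑ i, (t * (u i ⬝ᵥ y ω)) * g i)) ∂γ := by
    intro ω
    simp_rw [ofReal_exp_sum]
    rw [lintegral_pi_prod (gaussianReal 0 1)
      (fun i x => ENNReal.ofReal (Real.exp (t * (u i ⬝ᵥ y ω) * x))) (fun i => by fun_prop)]
    simp_rw [lintegral_exp_mul_gaussianReal]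
    rw [← ofReal_exp_sum]
    have := hpar (y ω)
    simp only [hy, Pi.add_apply] at this
    rw [← this, Finset.mul_sum]
    congr 2
    refine Finset.sum_congr rfl fun i _ => ?_
    rw [mul_pow, ht2]
    ring
  rw [lintegral_congr h1, lintegral_lintegral_swap (by
    refine Measurable.aemeasurable ?_
    refine ENNReal.measurable_ofReal.comp (Real.measurable_exp.comp ?_)
    refine Finset.measurable_sum _ fun i _ => ?_
    exact (((hym i).comp measurable_fst).const_mul t).mul
      ((measurable_pi_apply i).comp measurable_snd))]
  have h2 : ∀ g : m → ℝ, ∫⁻ ω, ENNReal.ofReal (Real.exp (∑ i, (t * (u i ⬝ᵥ y ω)) * g i)) ∂μ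
      ≤ ENNReal.ofReal (Real.exp (∑ i, (θ * s i * g i ^ 2 + t * (u i ⬝ᵥ b) * g i))) := by
    intro g
    have e : ∀ ω, ∑ i, (t * (u i ⬝ᵥ y ω)) * g i
        = ∑ i, t * (u i ⬝ᵥ b) * g i + ∑ k, (t * ∑ i, g i * (u i ᵥ* D) k) * X k ω := by
      intro ω
      simp only [hy, dotProduct_add, Matrix.dotProduct_mulVec]
      simp_rw [Finset.mul_sum, Finset.sum_mul]
      rw [Finset.sum_comm, ← Finset.sum_add_distrib]
      refine Finset.sum_congr rfl fun i _ => ?_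
      simp only [dotProduct]
      rw [mul_add, add_mul, add_comm]
      congr 1
      rw [Finset.mul_sum, Finset.sum_mul]
      exact Finset.sum_congr rfl fun k _ => by ring
    simp_rw [e, Real.exp_add, ENNReal.ofReal_mul (Real.exp_pos _).le]
    rw [lintegral_const_mul _ (by fun_prop)]
    refine (mul_le_mul_right (lintegral_exp_dotProduct_le hind hX _) _).trans ?_
    rw [← ENNReal.ofReal_mul (Real.exp_pos _).le, ← Real.exp_add]
    refine ENNReal.ofReal_le_ofReal (Real.exp_le_exp.2 (le_of_eq ?_))
    simp_rw [mul_pow]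
    rw [← Finset.mul_sum, hgram, ht2, Finset.sum_add_distrib, add_comm]
    congr 1
    rw [mul_div_assoc, mul_comm (2 : ℝ) θ, mul_assoc, Finset.sum_div, Finset.mul_sum,
      Finset.mul_sum]
    exact Finset.sum_congr rfl fun i _ => by ring
  refine (lintegral_mono h2).trans ?_
  simp_rw [ofReal_exp_sum]
  rw [lintegral_pi_prod (gaussianReal 0 1)
    (fun i x => ENNReal.ofReal (Real.exp (θ * s i * x ^ 2 + t * (u i ⬝ᵥ b) * x)))
    (fun i => by fun_prop)]
  have h3 : ∀ i, ∫⁻ x, ENNReal.ofReal (Real.exp (θ * s i * x ^ 2 + t * (u i ⬝ᵥ b) * x))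
      ∂gaussianReal 0 1 ≤ ENNReal.ofReal (Real.exp (4 / 3 * θ * (s i + (u i ⬝ᵥ b) ^ 2))) := by
    intro i
    refine (lintegral_exp_quadratic_gaussianReal_le (mul_nonneg hθ (hs i).1) ?_ _).trans_eq ?_
    · have := mul_le_mul_of_nonneg_left (hs i).2 hθ
      linarith
    · rw [mul_pow, ht2]
      ring_nf
  refine (Finset.prod_le_prod' fun i _ => h3 i).trans_eq ?_
  rw [← ofReal_exp_sum, ← Finset.mul_sum, Finset.sum_add_distrib, hpar, htr]

end SubGaussianChaos

/-! ### Decoupling of quadratic polynomials -/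

section Decoupling

variable {κ : Type*} [Fintype κ] [DecidableEq κ]

theorem sum_finset_symmDiff (i : κ) (f : Finset κ → ℝ) :
    ∑ I : Finset κ, f (symmDiff I {i}) = ∑ I : Finset κ, f I :=
  Equiv.sum_comp (Function.Involutive.toPerm (fun I : Finset κ => symmDiff I {i})
    fun I => symmDiff_symmDiff_cancel_right {i} I) f

theorem sum_indicator_mem (i : κ) :
    ∑ I : Finset κ, (if i ∈ I then (1 : ℝ) else 0) = Fintype.card (Finset κ) / 2 := by
  have h1 := sum_finset_symmDiff i fun I => if i ∈ I then (1 : ℝ) else 0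
  have h2 : ∑ I : Finset κ, (if i ∈ symmDiff I {i} then (1 : ℝ) else 0)
      + ∑ I : Finset κ, (if i ∈ I then (1 : ℝ) else 0) = Fintype.card (Finset κ) := by
    rw [← Finset.sum_add_distrib, Finset.sum_congr rfl (g := fun _ => (1 : ℝ))]
    · simp
    · intro I _
      by_cases h : i ∈ I <;> simp [Finset.mem_symmDiff, h]
  linarith

theorem sum_indicator_mem_notMem (i j : κ) :
    ∑ I : Finset κ, (if i ∈ I then (1 : ℝ) else 0) * (if j ∈ Iᶜ then 1 else 0)
      = Fintype.card (Finset κ) / 4 * (1 - if i = j then 1 else 0) := by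
  by_cases hij : i = j
  · subst hij
    simp only [if_true, sub_self, mul_zero]
    refine Finset.sum_eq_zero fun I _ => ?_
    by_cases h : i ∈ I <;> simp [h]
  have h1 := sum_finset_symmDiff i
    fun I => (if i ∈ I then (1 : ℝ) else 0) * (if j ∈ Iᶜ then 1 else 0)
  have h2 : ∑ I : Finset κ, (if i ∈ symmDiff I {i} then (1 : ℝ) else 0)
        * (if j ∈ (symmDiff I {i})ᶜ then 1 else 0)
      + ∑ I : Finset κ, (if i ∈ I then (1 : ℝ) else 0) * (if j ∈ Iᶜ then 1 else 0)
      + ∑ I : Finset κ, (if j ∈ I then (1 : ℝ) else 0) = Fintype.card (Finset κ) := by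
    rw [← Finset.sum_add_distrib, ← Finset.sum_add_distrib,
      Finset.sum_congr rfl (g := fun _ => (1 : ℝ))]
    · simp
    · intro I _
      have hji : j ≠ i := fun h => hij h.symm
      by_cases h : i ∈ I <;> by_cases h' : j ∈ I <;> simp [Finset.mem_symmDiff, h, h', hji]
  rw [sum_indicator_mem] at h2
  simp only [hij, if_false]
  linarith

/-- The part of an off-diagonal quadratic polynomial in `x` that pairs the coordinates in `I` with
those outside `I`. -/
def crossPart (W : Matrix κ κ ℝ) (b x : κ → ℝ) (I : Finset κ) : ℝ :=
  ∑ i ∈ I, x i * (∑ j ∈ Iᶜ, W i j * x j + b i)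

/-- Decoupling: an off-diagonal quadratic polynomial is four times the average of its cross parts
over all sets of coordinates. -/
theorem sum_crossPart (W : Matrix κ κ ℝ) (b x : κ → ℝ) :
    ∑ I : Finset κ, 4 * crossPart W b x I = Fintype.card (Finset κ) *
      (∑ i, ∑ j, W i j * x i * x j - ∑ i, W i i * x i ^ 2 + 2 * ∑ i, b i * x i) := by
  set N : ℝ := (Fintype.card (Finset κ) : ℝ)
  have h1 : ∀ I : Finset κ, crossPart W b x I
      = ∑ i, (∑ j, (W i j * x i * x j) * ((if i ∈ I then (1 : ℝ) else 0)
          * (if j ∈ Iᶜ then 1 else 0)) + b i * x i * (if i ∈ I then (1 : ℝ) else 0)) := by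
    intro I
    rw [crossPart, ← Finset.sum_subset (Finset.subset_univ I)]
    · refine Finset.sum_congr rfl fun i hi => ?_
      rw [← Finset.sum_subset (Finset.subset_univ Iᶜ)]
      · rw [mul_add, Finset.mul_sum]
        congr 1
        · refine Finset.sum_congr rfl fun j hj => ?_
          rw [if_pos hi, if_pos hj]; ring
        · rw [if_pos hi]; ring
      · intro j _ hj
        rw [if_neg hj]; ring
    · intro i _ hi
      simp [hi]
  simp_rw [h1, ← Finset.mul_sum]
  rw [Finset.sum_comm]
  simp_rw [Finset.sum_add_distrib]
  have h2 : ∀ i, ∑ I : Finset κ, ∑ j, (W i j * x i * x j) * ((if i ∈ I then (1 : ℝ) else 0)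
          * (if j ∈ Iᶜ then 1 else 0)) = N / 4 * (∑ j, W i j * x i * x j - W i i * x i ^ 2) := by
    intro i
    rw [Finset.sum_comm]
    simp_rw [← Finset.mul_sum, sum_indicator_mem_notMem]
    have h3 : ∀ j, W i j * x i * x j * (N / 4 * (1 - if i = j then 1 else 0))
        = N / 4 * (W i j * x i * x j - if i = j then W i j * x i * x j else 0) := by
      intro j; split_ifs <;> ring
    rw [Finset.sum_congr rfl fun j _ => h3 j, ← Finset.mul_sum, Finset.sum_sub_distrib,
      Finset.sum_ite_eq, if_pos (Finset.mem_univ i), mul_assoc (W i i), ← sq]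
  simp_rw [h2, ← Finset.mul_sum, sum_indicator_mem, Finset.sum_sub_distrib, ← Finset.sum_mul]
  ring

end Decoupling

section Chaos

variable {Ω : Type*} [MeasurableSpace Ω] {μ : Measure Ω}

/-- For independent `f` and `g`, one may replace `f` by an independent copy. -/
theorem lintegral_indepFun_eq {β γ : Type*} [MeasurableSpace β] [MeasurableSpace γ]
    [IsProbabilityMeasure μ] {f : Ω → β} {g : Ω → γ} (hf : Measurable f) (hg : Measurable g)
    (h : IndepFun f g μ) {F : β × γ → ℝ≥0∞} (hF : Measurable F) :
    ∫⁻ ω, F (f ω, g ω) ∂μ = ∫⁻ ω', ∫⁻ ω, F (f ω, g ω') ∂μ ∂μ := by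
  have : IsProbabilityMeasure (μ.map f) := Measure.isProbabilityMeasure_map hf.aemeasurable
  have : IsProbabilityMeasure (μ.map g) := Measure.isProbabilityMeasure_map hg.aemeasurable
  rw [← lintegral_map hF (hf.prodMk hg),
    (indepFun_iff_map_prod_eq_prod_map_map hf.aemeasurable hg.aemeasurable).1 h,
    lintegral_prod_symm' _ hF, lintegral_map (by fun_prop) hg]
  refine lintegral_congr fun ω' => ?_
  rw [lintegral_map (by fun_prop) hf]

variable {κ : Type*} [Fintype κ] [DecidableEq κ] {X : κ → Ω → ℝ}

/-- In a cross part, the coordinates in `I` enter linearly and are independent of the others.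
Averaging over them leaves the exponential of a squared norm of an affine image of the others. -/
theorem lintegral_exp_crossPart_le (hm : ∀ j, Measurable (X j))
    (hind : iIndepFun X μ) (hX : ∀ j, HasSubgaussianMGF (X j) 1 μ)
    (W : Matrix κ κ ℝ) (b : κ → ℝ) {t : ℝ} (ht : 8 * |t| * opNorm W ≤ 1) (I : Finset κ) :
    ∫⁻ ω, ENNReal.ofReal (Real.exp (4 * t * crossPart W b (fun j => X j ω) I)) ∂μ
      ≤ ENNReal.ofReal (Real.exp (32 / 3 * t ^ 2 * (frobNorm W ^ 2 + ∑ i, b i ^ 2))) := by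
  have : IsProbabilityMeasure μ := hind.isProbabilityMeasure
  set c : (↥Iᶜ → ℝ) → I → ℝ := fun z i => ∑ j : ↥Iᶜ, W i j * z j + b i with hc
  set F : (I → ℝ) × (↥Iᶜ → ℝ) → ℝ≥0∞ :=
    fun p => ENNReal.ofReal (Real.exp (∑ i, 4 * t * c p.2 i * p.1 i)) with hF
  have hFm : Measurable F := by
    simp only [hF, hc]
    fun_prop
  have h1 : ∀ ω, ENNReal.ofReal (Real.exp (4 * t * crossPart W b (fun j => X j ω) I))
      = F ((fun i : I => X i ω), (fun j : ↥Iᶜ => X j ω)) := by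
    intro ω
    simp only [hF, hc, crossPart]
    rw [Finset.mul_sum, ← Finset.sum_coe_sort I]
    congr 2
    refine Finset.sum_congr rfl fun i _ => ?_
    rw [← Finset.sum_coe_sort Iᶜ]
    ring
  rw [lintegral_congr h1, lintegral_indepFun_eq (by fun_prop) (by fun_prop)
    (hind.indepFun_finset I Iᶜ disjoint_compl_right hm) hFm]
  set D : Matrix I ↥Iᶜ ℝ := W.submatrix (fun i : I => (i : κ)) (fun j : ↥Iᶜ => (j : κ)) with hD
  have h2 : ∀ ω', ∫⁻ ω, F ((fun i : I => X i ω), (fun j : ↥Iᶜ => X j ω')) ∂μ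
      ≤ ENNReal.ofReal (Real.exp (8 * t ^ 2 *
          ∑ i, ((D *ᵥ fun j : ↥Iᶜ => X j ω') i + b i) ^ 2)) := by
    intro ω'
    refine (lintegral_exp_dotProduct_le (hind.precomp (g := fun i : I => (i : κ))
      Subtype.val_injective) (fun i => hX i)
      fun i => 4 * t * c (fun j : ↥Iᶜ => X j ω') i).trans_eq ?_
    congr 2
    rw [Finset.sum_div, Finset.mul_sum]
    refine Finset.sum_congr rfl fun i _ => ?_
    have e : (D *ᵥ fun j : ↥Iᶜ => X j ω') i + b i = c (fun j : ↥Iᶜ => X j ω') i := rfl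
    rw [e]
    ring
  refine (lintegral_mono h2).trans ?_
  have hDW : opNorm D ≤ opNorm W :=
    opNorm_submatrix_le W Subtype.val_injective Subtype.val_injective
  refine (lintegral_exp_sum_sq_le (fun j : ↥Iᶜ => hm j) (hind.precomp
    (g := fun i : ↥Iᶜ => (i : κ)) Subtype.val_injective) (fun i => hX i) D (fun i => b i)
    (by positivity) ?_).trans ?_
  · have h3 : (8 * |t| * opNorm D) ^ 2 ≤ 1 :=
      pow_le_one₀ (mul_nonneg (by positivity) (opNorm_nonneg _))
        (le_trans (mul_le_mul_of_nonneg_left hDW (by positivity)) ht)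
    rw [mul_pow, mul_pow, sq_abs] at h3
    linarith
  · refine ENNReal.ofReal_le_ofReal (Real.exp_le_exp.2 ?_)
    have h4 : frobNorm D ^ 2 ≤ frobNorm W ^ 2 := by
      rw [frobNorm_sq, frobNorm_sq]
      calc ∑ i : I, ∑ j : ↥Iᶜ, W i j ^ 2 = ∑ i ∈ I, ∑ j ∈ Iᶜ, W i j ^ 2 := by
            rw [← Finset.sum_coe_sort I]
            exact Finset.sum_congr rfl fun i _ => Finset.sum_coe_sort Iᶜ fun j => W i j ^ 2
        _ ≤ ∑ i, ∑ j ∈ Iᶜ, W i j ^ 2 := Finset.sum_le_sum_of_subset_of_nonneg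
            (Finset.subset_univ _) fun _ _ _ => Finset.sum_nonneg fun _ _ => sq_nonneg _
        _ ≤ _ := Finset.sum_le_sum fun i _ => Finset.sum_le_sum_of_subset_of_nonneg
            (Finset.subset_univ _) fun _ _ _ => sq_nonneg _
    have h5 : ∑ i : I, b i ^ 2 ≤ ∑ i, b i ^ 2 := by
      rw [Finset.sum_coe_sort I fun i => b i ^ 2]
      exact Finset.sum_le_sum_of_subset_of_nonneg (Finset.subset_univ _) fun _ _ _ => sq_nonneg _
    nlinarith [sq_nonneg t]

/-- Exponential moments of an off-diagonal quadratic polynomial of an independent sub-Gaussian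
vector. -/
theorem lintegral_exp_chaos_le (hm : ∀ j, Measurable (X j))
    (hind : iIndepFun X μ) (hX : ∀ j, HasSubgaussianMGF (X j) 1 μ)
    (W : Matrix κ κ ℝ) (b : κ → ℝ) {t : ℝ} (ht : 8 * |t| * opNorm W ≤ 1) :
    ∫⁻ ω, ENNReal.ofReal (Real.exp (t * (∑ i, ∑ j, W i j * X i ω * X j ω
        - ∑ i, W i i * X i ω ^ 2 + 2 * ∑ i, b i * X i ω))) ∂μ
      ≤ ENNReal.ofReal (Real.exp (32 / 3 * t ^ 2 * (frobNorm W ^ 2 + ∑ i, b i ^ 2))) := by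
  set N : ℝ := (Fintype.card (Finset κ) : ℝ) with hN
  have hN0 : 0 < N := by rw [hN]; exact_mod_cast Fintype.card_pos
  have h1 : ∀ ω, ENNReal.ofReal (Real.exp (t * (∑ i, ∑ j, W i j * X i ω * X j ω
        - ∑ i, W i i * X i ω ^ 2 + 2 * ∑ i, b i * X i ω)))
      ≤ ∑ I : Finset κ, ENNReal.ofReal N⁻¹ *
          ENNReal.ofReal (Real.exp (4 * t * crossPart W b (fun j => X j ω) I)) := by
    intro ω
    simp_rw [← ENNReal.ofReal_mul (inv_nonneg.2 hN0.le)]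
    rw [← ENNReal.ofReal_sum_of_nonneg fun I _ => by positivity]
    refine ENNReal.ofReal_le_ofReal ?_
    have h := convexOn_exp.map_sum_le (t := Finset.univ) (w := fun _ : Finset κ => N⁻¹)
      (p := fun I => 4 * t * crossPart W b (fun j => X j ω) I) (fun _ _ => by positivity)
      (by
        rw [Finset.sum_const, Finset.card_univ, nsmul_eq_mul, ← hN, mul_inv_cancel₀ hN0.ne'])
      (fun _ _ => Set.mem_univ _)
    simp only [smul_eq_mul] at h
    refine le_trans (le_of_eq ?_) h
    congr 1
    have h2 := sum_crossPart W b fun j => X j ω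
    rw [← Finset.mul_sum]
    simp_rw [mul_right_comm (4 : ℝ) t]
    rw [← Finset.sum_mul, h2, ← hN]
    field_simp
  refine (lintegral_mono h1).trans ?_
  have hmeas : ∀ I, Measurable fun ω => crossPart W b (fun j => X j ω) I := by
    intro I
    unfold crossPart
    fun_prop
  rw [lintegral_finsetSum _ fun I _ => by
    exact ((ENNReal.measurable_ofReal.comp (Real.measurable_exp.comp
      ((hmeas I).const_mul _))).const_mul _)]
  calc _ ≤ ∑ I : Finset κ, ENNReal.ofReal N⁻¹ * ENNReal.ofReal
        (Real.exp (32 / 3 * t ^ 2 * (frobNorm W ^ 2 + ∑ i, b i ^ 2))) := by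
        refine Finset.sum_le_sum fun I _ => ?_
        rw [lintegral_const_mul _ (by
          exact ENNReal.measurable_ofReal.comp (Real.measurable_exp.comp
            ((hmeas I).const_mul _)))]
        exact mul_le_mul_right (lintegral_exp_crossPart_le hm hind hX W b ht I) _
    _ = _ := by
        rw [Finset.sum_const, Finset.card_univ, nsmul_eq_mul, ← mul_assoc,
          ← ENNReal.ofReal_natCast, ← ENNReal.ofReal_mul (Nat.cast_nonneg _), ← hN,
          mul_inv_cancel₀ hN0.ne', ENNReal.ofReal_one, one_mul]

end Chaos

/-! ### The Hanson-Wright bound -/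

section Square

theorem cosh_sub_one_le {θ : ℝ} (hθ : |θ| ≤ 1) (w : ℝ) :
    Real.cosh (θ * w) - 1 ≤ θ ^ 2 * (Real.cosh w - 1) := by
  have h1 := (hasSum_nat_add_iff' 1).2 (Real.hasSum_cosh (θ * w))
  have h2 := ((hasSum_nat_add_iff' 1).2 (Real.hasSum_cosh w)).mul_left (θ ^ 2)
  simp only [Finset.range_one, Finset.sum_singleton, mul_zero, pow_zero, Nat.factorial_zero,
    Nat.cast_one, div_one] at h1 h2
  refine hasSum_le (fun n => ?_) h1 h2
  rw [mul_pow, ← mul_div_assoc]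
  have hw : 0 ≤ w ^ (2 * (n + 1)) := by rw [pow_mul]; positivity
  have h3 : θ ^ (2 * (n + 1)) ≤ θ ^ 2 := by
    rw [pow_mul]
    have : θ ^ 2 ≤ 1 := by rw [← sq_abs]; exact pow_le_one₀ (abs_nonneg _) hθ
    exact pow_le_of_le_one (sq_nonneg θ) this (Nat.succ_ne_zero n)
  gcongr

/-- A quadratic comparison that turns one exponential moment of a centred variable `w`, in both
directions, into bounds for all smaller ones. -/
theorem exp_mul_le {θ : ℝ} (hθ : |θ| ≤ 1) (w : ℝ) :
    Real.exp (θ * w) ≤ 1 + θ * w + θ ^ 2 * (Real.exp w + Real.exp (-w) - 2) := by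
  have h1 := cosh_sub_one_le hθ w
  rw [Real.cosh_eq, Real.cosh_eq] at h1
  have h2 := Real.add_one_le_exp (-(θ * w))
  linarith

variable {Ω : Type*} [MeasurableSpace Ω] {μ : Measure Ω} [IsProbabilityMeasure μ] {X : Ω → ℝ}

/-- The square is linearized by an auxiliary standard Gaussian variable. -/
theorem lintegral_exp_sq_div_four_le (hm : Measurable X) (hX : HasSubgaussianMGF X 1 μ) :
    ∫⁻ ω, ENNReal.ofReal (Real.exp (X ω ^ 2 / 4)) ∂μ ≤ ENNReal.ofReal (√2) := by
  have h2 : √2 ^ 2 = 2 := Real.sq_sqrt (by norm_num)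
  have h1 : ∀ ω, ENNReal.ofReal (Real.exp (X ω ^ 2 / 4))
      = ∫⁻ g, ENNReal.ofReal (Real.exp (X ω / √2 * g)) ∂gaussianReal 0 1 := by
    intro ω
    rw [lintegral_exp_mul_gaussianReal, div_pow, h2]
    congr 2
    ring
  rw [lintegral_congr h1, lintegral_lintegral_swap (by fun_prop)]
  have h3 : ∀ g : ℝ, ∫⁻ ω, ENNReal.ofReal (Real.exp (X ω / √2 * g)) ∂μ
      ≤ ENNReal.ofReal (Real.exp (1 / 4 * g ^ 2 + 0 * g)) := by
    intro g
    have e : ∀ ω, X ω / √2 * g = g / √2 * X ω := fun ω => by ring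
    simp_rw [e]
    rw [lintegral_ofReal_exp (hX.integrable_exp_mul _)]
    refine ENNReal.ofReal_le_ofReal ((hX.mgf_le (g / √2)).trans_eq ?_)
    rw [div_pow, h2]
    congr 1
    push_cast
    ring
  refine (lintegral_mono h3).trans_eq ?_
  rw [lintegral_exp_quadratic_gaussianReal (by norm_num)]
  congr 1
  rw [show (1 : ℝ) - 2 * (1 / 4) = 2⁻¹ by norm_num, Real.sqrt_inv]
  simp

/-- The centred square of a sub-Gaussian variable has exponential moments like a sub-exponential
variable. -/
theorem lintegral_exp_sq_sub_le (hm : Measurable X) (hX : HasSubgaussianMGF X 1 μ) {t : ℝ}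
    (ht : |t| ≤ 1 / 4) :
    ∫⁻ ω, ENNReal.ofReal (Real.exp (t * (X ω ^ 2 - ∫ ω', X ω' ^ 2 ∂μ))) ∂μ
      ≤ ENNReal.ofReal (Real.exp (7 * t ^ 2)) := by
  set m : ℝ := ∫ ω, X ω ^ 2 ∂μ with hmdef
  have hsq : Integrable (fun ω => X ω ^ 2) μ := (hX.memLp 2).integrable_sq
  have hcen : Integrable (fun ω => X ω ^ 2 - m) μ := hsq.sub (integrable_const _)
  have hq := lintegral_exp_sq_div_four_le hm hX
  have hI : Integrable (fun ω => Real.exp (X ω ^ 2 / 4)) μ := by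
    refine ⟨by fun_prop, ?_⟩
    rw [hasFiniteIntegral_iff_ofReal (ae_of_all _ fun _ => (Real.exp_pos _).le)]
    exact hq.trans_lt ENNReal.ofReal_lt_top
  rw [lintegral_ofReal_exp hI, ENNReal.ofReal_le_ofReal_iff (Real.sqrt_nonneg 2)] at hq
  have hA : Integrable (fun ω => Real.exp ((X ω ^ 2 - m) / 4)) μ := by
    refine (hI.mul_const (Real.exp (-m / 4))).congr (ae_of_all _ fun ω => ?_)
    simp only []
    rw [← Real.exp_add]
    ring_nf
  have hB : Integrable (fun ω => Real.exp (-((X ω ^ 2 - m) / 4))) μ := by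
    refine (integrable_const (Real.exp (m / 4))).mono' (by fun_prop) (ae_of_all _ fun ω => ?_)
    rw [Real.norm_eq_abs, abs_of_pos (Real.exp_pos _)]
    exact Real.exp_le_exp.2 (by nlinarith [sq_nonneg (X ω)])
  have hmean : ∫ ω, (X ω ^ 2 - m) ∂μ = 0 := by
    rw [integral_sub hsq (integrable_const _)]
    simp [hmdef]
  set v : ℝ := Real.exp (m / 4) with hv
  have hv0 : 0 < v := Real.exp_pos _
  have hv1 : 1 ≤ v := Real.one_le_exp (div_nonneg (integral_nonneg fun _ => sq_nonneg _)
    (by norm_num))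
  have hAv : (∫ ω, Real.exp ((X ω ^ 2 - m) / 4) ∂μ) * v ≤ √2 := by
    rw [← integral_mul_const]
    refine (integral_congr_ae (ae_of_all _ fun ω => ?_)).trans_le hq
    simp only [hv]
    rw [← Real.exp_add]
    ring_nf
  have hcen4 : Integrable (fun ω => (X ω ^ 2 - m) / 4) μ := hcen.div_const _
  have hA1 : 1 ≤ ∫ ω, Real.exp ((X ω ^ 2 - m) / 4) ∂μ := by
    calc (1 : ℝ) = ∫ ω, ((X ω ^ 2 - m) / 4 + 1) ∂μ := by
          rw [integral_add hcen4 (integrable_const _), integral_div, hmean]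
          simp
      _ ≤ _ := integral_mono (hcen4.add (integrable_const _)) hA fun ω => Real.add_one_le_exp _
  have hBv : ∫ ω, Real.exp (-((X ω ^ 2 - m) / 4)) ∂μ ≤ v := by
    refine (integral_mono hB (integrable_const v) fun ω => ?_).trans_eq (by simp)
    exact Real.exp_le_exp.2 (by nlinarith [sq_nonneg (X ω)])
  set a := ∫ ω, Real.exp ((X ω ^ 2 - m) / 4) ∂μ
  set b := ∫ ω, Real.exp (-((X ω ^ 2 - m) / 4)) ∂μ
  -- `a + b ≤ √2 / v + v` and `v` lies between `1` and `√2`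
  have hab : 16 * (a + b - 2) ≤ 7 := by
    have h2 : √2 ^ 2 = 2 := Real.sq_sqrt (by norm_num)
    have h2' : √2 ≤ 1.43 := by
      rw [show (1.43 : ℝ) = √(1.43 ^ 2) by rw [Real.sqrt_sq]; norm_num]
      exact Real.sqrt_le_sqrt (by norm_num)
    have hvs : v ≤ √2 := by nlinarith
    have h3 : a + v ≤ 1 + √2 := by
      by_contra hlt
      push Not at hlt
      nlinarith [mul_nonneg (sub_nonneg.2 hv1) (sub_nonneg.2 hvs)]
    norm_num at h2' ⊢
    linarith
  have hpt : ∀ ω, Real.exp (t * (X ω ^ 2 - m)) ≤ 1 + t * (X ω ^ 2 - m)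
      + 16 * t ^ 2 * (Real.exp ((X ω ^ 2 - m) / 4) + Real.exp (-((X ω ^ 2 - m) / 4)) - 2) := by
    intro ω
    have h := exp_mul_le (θ := 4 * t) (by rw [abs_mul, abs_of_pos (by norm_num)]; linarith)
      ((X ω ^ 2 - m) / 4)
    calc _ = Real.exp (4 * t * ((X ω ^ 2 - m) / 4)) := by ring_nf
      _ ≤ _ := h
      _ = _ := by ring
  have hint1 : Integrable (fun ω => 1 + t * (X ω ^ 2 - m)) μ :=
    (integrable_const _).add (hcen.const_mul _)
  have hAB : Integrable (fun ω => Real.exp ((X ω ^ 2 - m) / 4)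
      + Real.exp (-((X ω ^ 2 - m) / 4))) μ := hA.add hB
  have hint2 : Integrable (fun ω => 16 * t ^ 2 * (Real.exp ((X ω ^ 2 - m) / 4)
      + Real.exp (-((X ω ^ 2 - m) / 4)) - 2)) μ :=
    (hAB.sub (integrable_const _)).const_mul _
  refine (lintegral_mono fun ω => ENNReal.ofReal_le_ofReal (hpt ω)).trans ?_
  have hint : Integrable (fun ω => 1 + t * (X ω ^ 2 - m) + 16 * t ^ 2 *
      (Real.exp ((X ω ^ 2 - m) / 4) + Real.exp (-((X ω ^ 2 - m) / 4)) - 2)) μ := hint1.add hint2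
  rw [← ofReal_integral_eq_lintegral_ofReal hint
    (ae_of_all _ fun ω => (Real.exp_pos _).le.trans (hpt ω))]
  refine ENNReal.ofReal_le_ofReal ?_
  have e1 : ∫ ω, (1 + t * (X ω ^ 2 - m)) ∂μ = 1 := by
    rw [integral_add (integrable_const _) (hcen.const_mul _),
      integral_const_mul, hmean]
    simp
  have e2 : ∫ ω, 16 * t ^ 2 * (Real.exp ((X ω ^ 2 - m) / 4)
      + Real.exp (-((X ω ^ 2 - m) / 4)) - 2) ∂μ = 16 * t ^ 2 * (a + b - 2) := by
    rw [integral_const_mul, integral_sub hAB (integrable_const _), integral_add hA hB]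
    simp [a, b]
  rw [integral_add hint1 hint2, e1, e2]
  refine le_trans ?_ (Real.add_one_le_exp _)
  nlinarith [sq_nonneg t]

end Square

section HansonWright

variable {Ω : Type*} [MeasurableSpace Ω] {μ : Measure Ω}
  {κ : Type*} [Fintype κ] {X : κ → Ω → ℝ}

theorem lintegral_exp_sum_sq_sub_le (hm : ∀ j, Measurable (X j))
    (hind : iIndepFun X μ) (hX : ∀ j, HasSubgaussianMGF (X j) 1 μ) (c : κ → ℝ)
    (hc : ∀ j, |c j| ≤ 1 / 4) :
    ∫⁻ ω, ENNReal.ofReal (Real.exp (∑ j, c j * (X j ω ^ 2 - ∫ ω', X j ω' ^ 2 ∂μ))) ∂μ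
      ≤ ENNReal.ofReal (Real.exp (7 * ∑ j, c j ^ 2)) := by
  have : IsProbabilityMeasure μ := hind.isProbabilityMeasure
  simp_rw [ofReal_exp_sum, Finset.mul_sum]
  rw [lintegral_prod_eq_prod_lintegral_of_indepFun Finset.univ
    (fun j ω => ENNReal.ofReal (Real.exp (c j * (X j ω ^ 2 - ∫ ω', X j ω' ^ 2 ∂μ))))
    (hind.comp (fun j x => ENNReal.ofReal (Real.exp (c j * (x ^ 2 - ∫ ω', X j ω' ^ 2 ∂μ))))
      fun j => by fun_prop) fun j => by fun_prop, ofReal_exp_sum]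
  exact Finset.prod_le_prod' fun j _ => lintegral_exp_sq_sub_le (hm j) (hX j) (hc j)

/-- A Hanson-Wright bound: exponential moments of the centred squared norm of a linear image of an
independent sub-Gaussian vector. The diagonal and the off-diagonal part are separated by
`exp (a + b) ≤ (exp (2 a) + exp (2 b)) / 2`. -/
theorem lintegral_exp_sum_mulVec_sq_sub_le [DecidableEq κ] {n : Type*} [Fintype n] [DecidableEq n]
    (hm : ∀ j, Measurable (X j))
    (hind : iIndepFun X μ) (hX : ∀ j, HasSubgaussianMGF (X j) 1 μ) (C : Matrix n κ ℝ) {t : ℝ}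
    (ht : 16 * |t| * opNorm C ^ 2 ≤ 1) :
    ∫⁻ ω, ENNReal.ofReal (Real.exp (t * (∑ i, (C *ᵥ fun j => X j ω) i ^ 2
        - ∑ j, (∑ i, C i j ^ 2) * ∫ ω', X j ω' ^ 2 ∂μ))) ∂μ
      ≤ ENNReal.ofReal (Real.exp (128 / 3 * t ^ 2 * (opNorm C ^ 2 * frobNorm C ^ 2))) := by
  set W : Matrix κ κ ℝ := Cᵀ * C with hW
  have hWop : opNorm W ≤ opNorm C ^ 2 := by
    refine (opNorm_mul_le _ _).trans_eq ?_
    rw [opNorm_transpose, sq]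
  have hWfr : frobNorm W ^ 2 ≤ opNorm C ^ 2 * frobNorm C ^ 2 := by
    rw [← mul_pow]
    refine pow_le_pow_left₀ (frobNorm_nonneg _) ?_ 2
    rw [← opNorm_transpose C]
    exact frobNorm_mul_le _ _
  have hdiag : ∀ j, W j j = ∑ i, C i j ^ 2 := fun j => by
    simp [hW, Matrix.mul_apply, sq]
  have hquad : ∀ ω, ∑ i, (C *ᵥ fun j => X j ω) i ^ 2 = ∑ i, ∑ j, W i j * X i ω * X j ω := by
    intro ω
    have h1 : (C *ᵥ fun j => X j ω) ⬝ᵥ (C *ᵥ fun j => X j ω)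
        = (fun j => X j ω) ⬝ᵥ (W *ᵥ fun j => X j ω) := by
      rw [hW, ← Matrix.mulVec_mulVec, Matrix.dotProduct_mulVec _ Cᵀ, Matrix.vecMul_transpose]
    simp only [dotProduct, ← sq] at h1
    rw [h1]
    simp only [Matrix.mulVec, dotProduct, Finset.mul_sum]
    exact Finset.sum_congr rfl fun i _ => Finset.sum_congr rfl fun j _ => by ring
  have hoff := lintegral_exp_chaos_le hm hind hX W 0 (t := 2 * t) (by
    rw [abs_mul, abs_of_pos (by norm_num : (0 : ℝ) < 2)]
    nlinarith [abs_nonneg t])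
  have hdg := lintegral_exp_sum_sq_sub_le hm hind hX (fun j => 2 * t * W j j) (by
    intro j
    rw [abs_mul, abs_mul, abs_of_pos (by norm_num : (0 : ℝ) < 2), hdiag,
      abs_of_nonneg (Finset.sum_nonneg fun i _ => sq_nonneg (C i j))]
    nlinarith [abs_nonneg t, sum_col_sq_le C j])
  have hWd : ∑ j, (2 * t * W j j) ^ 2 ≤ 4 * t ^ 2 * frobNorm W ^ 2 := by
    rw [frobNorm_sq, Finset.mul_sum]
    refine Finset.sum_le_sum fun i _ => ?_
    have := Finset.single_le_sum (f := fun j => W i j ^ 2) (fun j _ => sq_nonneg _)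
      (Finset.mem_univ i)
    nlinarith [sq_nonneg t]
  set U : Ω → ℝ := fun ω => ∑ i, ∑ j, W i j * X i ω * X j ω - ∑ i, W i i * X i ω ^ 2
    + 2 * ∑ i, (0 : κ → ℝ) i * X i ω with hU
  set V : Ω → ℝ := fun ω => ∑ j, 2 * t * W j j * (X j ω ^ 2 - ∫ ω', X j ω' ^ 2 ∂μ) with hV
  have hUm : Measurable U := by fun_prop
  have hVm : Measurable V := by fun_prop
  have hsplit : ∀ ω, ENNReal.ofReal (Real.exp (t * (∑ i, (C *ᵥ fun j => X j ω) i ^ 2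
        - ∑ j, (∑ i, C i j ^ 2) * ∫ ω', X j ω' ^ 2 ∂μ)))
      ≤ ENNReal.ofReal (1 / 2) * ENNReal.ofReal (Real.exp (2 * t * U ω))
        + ENNReal.ofReal (1 / 2) * ENNReal.ofReal (Real.exp (V ω)) := by
    intro ω
    rw [← ENNReal.ofReal_mul (by norm_num), ← ENNReal.ofReal_mul (by norm_num),
      ← ENNReal.ofReal_add (by positivity) (by positivity)]
    refine ENNReal.ofReal_le_ofReal ?_
    have e : t * (∑ i, (C *ᵥ fun j => X j ω) i ^ 2
        - ∑ j, (∑ i, C i j ^ 2) * ∫ ω', X j ω' ^ 2 ∂μ) = t * U ω + V ω / 2 := by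
      have eV : V ω = 2 * t * (∑ j, W j j * X j ω ^ 2 - ∑ j, W j j * ∫ ω', X j ω' ^ 2 ∂μ) := by
        simp only [hV]
        rw [← Finset.sum_sub_distrib, Finset.mul_sum]
        exact Finset.sum_congr rfl fun j _ => by ring
      rw [eV, hquad]
      simp only [hU, ← hdiag, Pi.zero_apply, zero_mul, Finset.sum_const_zero]
      ring
    rw [e, Real.exp_add]
    have h1 : Real.exp (2 * t * U ω) = Real.exp (t * U ω) ^ 2 := by
      rw [← Real.exp_nat_mul]; congr 1; push_cast; ring
    have h2 : Real.exp (V ω) = Real.exp (V ω / 2) ^ 2 := by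
      rw [← Real.exp_nat_mul]; congr 1; push_cast; ring
    rw [h1, h2]
    nlinarith [sq_nonneg (Real.exp (t * U ω) - Real.exp (V ω / 2))]
  set E : ℝ := 128 / 3 * t ^ 2 * (opNorm C ^ 2 * frobNorm C ^ 2) with hE
  have hoff' : ∫⁻ ω, ENNReal.ofReal (Real.exp (2 * t * U ω)) ∂μ ≤ ENNReal.ofReal (Real.exp E) := by
    refine hoff.trans (ENNReal.ofReal_le_ofReal (Real.exp_le_exp.2 ?_))
    simp only [Pi.zero_apply, ne_eq, OfNat.ofNat_ne_zero, not_false_eq_true, zero_pow,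
      Finset.sum_const_zero, add_zero]
    nlinarith [sq_nonneg t]
  have hdg' : ∫⁻ ω, ENNReal.ofReal (Real.exp (V ω)) ∂μ ≤ ENNReal.ofReal (Real.exp E) := by
    refine hdg.trans (ENNReal.ofReal_le_ofReal (Real.exp_le_exp.2 ?_))
    have := mul_le_mul_of_nonneg_left hWfr (sq_nonneg t)
    have h0 : 0 ≤ t ^ 2 * frobNorm W ^ 2 := by positivity
    linarith
  calc _ ≤ ∫⁻ ω, (ENNReal.ofReal (1 / 2) * ENNReal.ofReal (Real.exp (2 * t * U ω))
        + ENNReal.ofReal (1 / 2) * ENNReal.ofReal (Real.exp (V ω))) ∂μ := lintegral_mono hsplit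
    _ = ENNReal.ofReal (1 / 2) * ∫⁻ ω, ENNReal.ofReal (Real.exp (2 * t * U ω)) ∂μ
        + ENNReal.ofReal (1 / 2) * ∫⁻ ω, ENNReal.ofReal (Real.exp (V ω)) ∂μ := by
        rw [lintegral_add_left (by fun_prop), lintegral_const_mul _ (by fun_prop),
          lintegral_const_mul _ (by fun_prop)]
    _ ≤ ENNReal.ofReal (1 / 2) * ENNReal.ofReal (Real.exp E)
        + ENNReal.ofReal (1 / 2) * ENNReal.ofReal (Real.exp E) := by gcongr
    _ = ENNReal.ofReal (Real.exp E) := by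
        rw [← add_mul, ← ENNReal.ofReal_add (by norm_num) (by norm_num)]
        norm_num

end HansonWright

/-! ### The random signs -/

section Signs

theorem bitSign_sq (b : Bool) : bitSign b ^ 2 = 1 := by cases b <;> simp [bitSign]

theorem integral_bitSign : ∫ b, bitSign b ∂(PMF.uniformOfFintype Bool).toMeasure = 0 := by
  rw [PMF.integral_eq_sum]
  simp [bitSign]

variable {K M : ℕ}

/-- The joint law of the independent uniform signs of all users and channel uses. -/
noncomputable abbrev signLaw (K M : ℕ) : Measure (Fin K → Fin M → Bool) :=
  Measure.pi fun _ => Measure.pi fun _ => (PMF.uniformOfFintype Bool).toMeasure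

theorem measurable_sign (q : Fin K × Fin M) :
    Measurable fun u : Fin K → Fin M → Bool => bitSign (u q.1 q.2) :=
  (measurable_of_finite bitSign).comp ((measurable_pi_apply q.2).comp (measurable_pi_apply q.1))

theorem hasSubgaussianMGF_sign (q : Fin K × Fin M) :
    HasSubgaussianMGF (fun u : Fin K → Fin M → Bool => bitSign (u q.1 q.2)) 1 (signLaw K M) := by
  have h := hasSubgaussianMGF_of_mem_Icc_of_integral_eq_zero (μ := signLaw K M) (a := -1) (b := 1)
    (measurable_sign q).aemeasurable (ae_of_all _ fun u => by
      cases u q.1 q.2 <;> simp [bitSign]) (by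
      have h1 : MeasurePreserving (fun u : Fin K → Fin M → Bool => u q.1 q.2) (signLaw K M)
          (PMF.uniformOfFintype Bool).toMeasure :=
        (measurePreserving_eval (fun _ : Fin M => (PMF.uniformOfFintype Bool).toMeasure) q.2).comp
          (measurePreserving_eval (fun _ : Fin K => Measure.pi fun _ : Fin M =>
            (PMF.uniformOfFintype Bool).toMeasure) q.1)
      rw [← integral_bitSign, ← h1.map_eq, integral_map h1.measurable.aemeasurable
        (measurable_of_finite bitSign).aestronglyMeasurable])
  convert h using 1
  ext
  norm_num

theorem iIndepFun_sign : iIndepFun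
    (fun (q : Fin K × Fin M) (u : Fin K → Fin M → Bool) => bitSign (u q.1 q.2)) (signLaw K M) := by
  have h := iIndepFun_uncurry_infinitePi'
    (fun (_ : Fin K) (_ : Fin M) => (PMF.uniformOfFintype Bool).toMeasure)
    (X := fun _ _ => bitSign) (fun _ _ => measurable_of_finite bitSign)
  simpa [Measure.infinitePi_eq_pi] using h

end Signs

/-! ### The receive matrix and its Gram matrices -/

section Gram

variable {K M : ℕ}

/-- The diagonal blocks, one for each channel use, that a matrix indexed by the fading coefficients
has in the real dimension `i`. -/
def fadingBlocks (T : Matrix (FadingIdx K M) (FadingIdx K M) ℝ) (i : Fin 2) :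
    Matrix (Fin K × Fin M) (Fin K × Fin M) ℝ :=
  fun p q => if p.2 = q.2 then T (p.2, i, p.1) (q.2, i, q.1) else 0

theorem opNorm_fadingBlocks_le (T : Matrix (FadingIdx K M) (FadingIdx K M) ℝ) (i : Fin 2) :
    opNorm (fadingBlocks T i) ≤ opNorm T := by
  refine opNorm_le (opNorm_nonneg _) fun x => ?_
  have h1 : ∀ (k : Fin K) (m : Fin M), (fadingBlocks T i *ᵥ x) (k, m)
      = (T.submatrix (fun l : Fin K => (m, i, l)) (fun l : Fin K => (m, i, l)) *ᵥ
          fun l => x (l, m)) k := by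
    intro k m
    simp only [Matrix.mulVec, dotProduct, fadingBlocks, Matrix.submatrix_apply,
      Fintype.sum_prod_type]
    refine Finset.sum_congr rfl fun l _ => ?_
    rw [Finset.sum_eq_single m] <;> simp +contextual [eq_comm]
  rw [Fintype.sum_prod_type, Fintype.sum_prod_type, Finset.sum_comm,
    Finset.sum_comm (f := fun k m => x (k, m) ^ 2), Finset.mul_sum]
  refine Finset.sum_le_sum fun m _ => ?_
  simp_rw [h1]
  refine (sum_mulVec_sq_le _ _).trans ?_
  refine mul_le_mul_of_nonneg_right (pow_le_pow_left₀ (opNorm_nonneg _) ?_ 2)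
    (Finset.sum_nonneg fun _ _ => sq_nonneg _)
  exact opNorm_submatrix_le T (fun _ _ h => by simpa using h) (fun _ _ h => by simpa using h)

theorem frobNorm_fadingBlocks_sq (T : Matrix (FadingIdx K M) (FadingIdx K M) ℝ) (i : Fin 2) :
    frobNorm (fadingBlocks T i) ^ 2 = ∑ m, ∑ k, ∑ l, T (m, i, k) (m, i, l) ^ 2 := by
  rw [frobNorm_sq, Fintype.sum_prod_type, Finset.sum_comm]
  refine Finset.sum_congr rfl fun m _ => Finset.sum_congr rfl fun k _ => ?_
  rw [Fintype.sum_prod_type]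
  refine Finset.sum_congr rfl fun l _ => ?_
  rw [Finset.sum_eq_single m] <;> simp +contextual [fadingBlocks, eq_comm]

theorem frobNorm_add_fadingBlocks_sq_le (T : Matrix (FadingIdx K M) (FadingIdx K M) ℝ) :
    frobNorm (fadingBlocks T 0 + fadingBlocks T 1) ^ 2 ≤ 2 * frobNorm T ^ 2 := by
  have h1 : frobNorm (fadingBlocks T 0) ^ 2 + frobNorm (fadingBlocks T 1) ^ 2
      ≤ frobNorm T ^ 2 := by
    rw [frobNorm_fadingBlocks_sq, frobNorm_fadingBlocks_sq, frobNorm_sq, Fintype.sum_prod_type,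
      ← Finset.sum_add_distrib]
    refine Finset.sum_le_sum fun m _ => ?_
    rw [Fintype.sum_prod_type, Fin.sum_univ_two]
    have h2 : ∀ (i : Fin 2) (k : Fin K), ∑ l, T (m, i, k) (m, i, l) ^ 2
        ≤ ∑ q, T (m, i, k) q ^ 2 := by
      intro i k
      rw [Fintype.sum_prod_type]
      refine le_trans ?_ (Finset.single_le_sum (f := fun m' => ∑ q, T (m, i, k) (m', q) ^ 2)
        (fun _ _ => Finset.sum_nonneg fun _ _ => sq_nonneg _) (Finset.mem_univ m))
      rw [Fintype.sum_prod_type]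
      exact Finset.single_le_sum (f := fun i' => ∑ l, T (m, i, k) (m, i', l) ^ 2)
        (fun _ _ => Finset.sum_nonneg fun _ _ => sq_nonneg _) (Finset.mem_univ i)
    exact add_le_add (Finset.sum_le_sum fun k _ => h2 0 k) (Finset.sum_le_sum fun k _ => h2 1 k)
  have h3 := pow_le_pow_left₀ (frobNorm_nonneg _)
    (frobNorm_add_le (fadingBlocks T 0) (fadingBlocks T 1)) 2
  nlinarith [sq_nonneg (frobNorm (fadingBlocks T 0) - frobNorm (fadingBlocks T 1))]

theorem sum_fadingNoise_sq_le (V : Matrix (FadingIdx K M) (NoiseIdx M) ℝ) :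
    ∑ q : Fin K × Fin M, (V (q.2, 0, q.1) (q.2, 0) + V (q.2, 1, q.1) (q.2, 1)) ^ 2
      ≤ 2 * frobNorm V ^ 2 := by
  rw [Fintype.sum_prod_type, Finset.sum_comm, frobNorm_sq, Fintype.sum_prod_type, Finset.mul_sum]
  refine Finset.sum_le_sum fun m _ => ?_
  rw [Fintype.sum_prod_type, Fin.sum_univ_two, ← Finset.sum_add_distrib, Finset.mul_sum]
  refine Finset.sum_le_sum fun k _ => ?_
  have h : ∀ i : Fin 2, V (m, i, k) (m, i) ^ 2 ≤ ∑ q, V (m, i, k) q ^ 2 := fun i =>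
    Finset.single_le_sum (f := fun q => V (m, i, k) q ^ 2) (fun _ _ => sq_nonneg _)
      (Finset.mem_univ (m, i))
  nlinarith [h 0, h 1, sq_nonneg (V (m, 0, k) (m, 0) - V (m, 1, k) (m, 1))]

end Gram

section ReceiveMatrix

variable {K M : ℕ} {κ : Type*}

/-- The matrix by which the fading vector enters the channel output if user `k` sends
`√(b k) * u k m` at channel use `m`. -/
noncomputable def signMatrix (b : Fin K → ℝ) (u : Fin K → Fin M → ℝ) :
    Matrix (NoiseIdx M) (FadingIdx K M) ℝ :=
  fun p q => if p.1 = q.1 ∧ p.2 = q.2.1 then √(b q.2.2) * u q.2.2 q.1 else 0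

theorem sum_signMatrix_mul (b : Fin K → ℝ) (u : Fin K → Fin M → ℝ) (h : FadingIdx K M → ℝ)
    (m : Fin M) (i : Fin 2) :
    ∑ q, signMatrix b u (m, i) q * h q = ∑ k, √(b k) * u k m * h (m, i, k) := by
  rw [Fintype.sum_prod_type, Finset.sum_eq_single m, Fintype.sum_prod_type,
    Finset.sum_eq_single i]
  · simp [signMatrix]
  · intro i' _ hi
    exact Finset.sum_eq_zero fun k _ => by simp [signMatrix, Ne.symm hi]
  · simp
  · intro m' _ hm
    exact Finset.sum_eq_zero fun k _ => by simp [signMatrix, Ne.symm hm]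
  · simp

theorem opNorm_signMatrix_le {b : Fin K → ℝ} (hb : ∀ k, 0 ≤ b k) {u : Fin K → Fin M → ℝ}
    (hu : ∀ k m, u k m ^ 2 = 1) : opNorm (signMatrix b u) ≤ √(∑ k, b k) := by
  have hs : 0 ≤ ∑ k, b k := Finset.sum_nonneg fun k _ => hb k
  refine opNorm_le (Real.sqrt_nonneg _) fun x => ?_
  rw [Real.sq_sqrt hs, Fintype.sum_prod_type, Fintype.sum_prod_type, Finset.mul_sum]
  refine Finset.sum_le_sum fun m _ => ?_
  rw [Fintype.sum_prod_type, Finset.mul_sum]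
  refine Finset.sum_le_sum fun i _ => ?_
  rw [show (signMatrix b u *ᵥ x) (m, i) = _ from sum_signMatrix_mul b u x m i]
  refine (Finset.sum_mul_sq_le_sq_mul_sq _ _ _).trans_eq ?_
  congr 1
  refine Finset.sum_congr rfl fun k _ => ?_
  rw [mul_pow, hu, mul_one, Real.sq_sqrt (hb k)]

/-- The matrix that takes the source vector to the channel output. -/
noncomputable def receiveMatrix (b : Fin K → ℝ) (A : Matrix (FadingIdx K M) κ ℝ)
    (B : Matrix (NoiseIdx M) κ ℝ) (u : Fin K → Fin M → Bool) : Matrix (NoiseIdx M) κ ℝ :=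
  signMatrix b (fun k m => bitSign (u k m)) * A + B

theorem receiveMatrix_apply (b : Fin K → ℝ) (A : Matrix (FadingIdx K M) κ ℝ)
    (B : Matrix (NoiseIdx M) κ ℝ) (u : Fin K → Fin M → Bool) (m : Fin M) (i : Fin 2) (j : κ) :
    receiveMatrix b A B u (m, i) j
      = ∑ k, bitSign (u k m) * (√(b k) * A (m, i, k) j) + B (m, i) j := by
  rw [receiveMatrix, Matrix.add_apply, Matrix.mul_apply, sum_signMatrix_mul]
  congr 1
  exact Finset.sum_congr rfl fun k _ => by ring

variable [Fintype κ]

theorem opNorm_receiveMatrix_le [DecidableEq κ] {b : Fin K → ℝ} (hb : ∀ k, 0 ≤ b k)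
    (A : Matrix (FadingIdx K M) κ ℝ) (B : Matrix (NoiseIdx M) κ ℝ) (u : Fin K → Fin M → Bool) :
    opNorm (receiveMatrix b A B u) ≤ √(∑ k, b k) * opNorm A + opNorm B := by
  refine (opNorm_add_le _ _).trans (add_le_add_left ((opNorm_mul_le _ _).trans ?_) _)
  exact mul_le_mul_of_nonneg_right (opNorm_signMatrix_le hb fun _ _ => bitSign_sq _)
    (opNorm_nonneg _)

theorem frobNorm_receiveMatrix_le {b : Fin K → ℝ} (hb : ∀ k, 0 ≤ b k)
    (A : Matrix (FadingIdx K M) κ ℝ) (B : Matrix (NoiseIdx M) κ ℝ) (u : Fin K → Fin M → Bool) :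
    frobNorm (receiveMatrix b A B u) ≤ √(∑ k, b k) * frobNorm A + frobNorm B := by
  refine (frobNorm_add_le _ _).trans (add_le_add_left ((frobNorm_mul_le _ _).trans ?_) _)
  exact mul_le_mul_of_nonneg_right (opNorm_signMatrix_le hb fun _ _ => bitSign_sq _)
    (frobNorm_nonneg _)

theorem opNorm_weighted_le [DecidableEq κ] {b : Fin K → ℝ} (hb : ∀ k, 0 ≤ b k)
    (A : Matrix (FadingIdx K M) κ ℝ) :
    opNorm (Matrix.diagonal (fun q : FadingIdx K M => √(b q.2.2)) * A)
      ≤ √(∑ k, b k) * opNorm A := by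
  refine (opNorm_mul_le _ _).trans (mul_le_mul_of_nonneg_right ?_ (opNorm_nonneg _))
  refine opNorm_diagonal_le (Real.sqrt_nonneg _) fun q => ?_
  rw [abs_of_nonneg (Real.sqrt_nonneg _)]
  exact Real.sqrt_le_sqrt (Finset.single_le_sum (fun k _ => hb k) (Finset.mem_univ q.2.2))

theorem frobNorm_weighted_le {b : Fin K → ℝ} (hb : ∀ k, 0 ≤ b k) (A : Matrix (FadingIdx K M) κ ℝ) :
    frobNorm (Matrix.diagonal (fun q : FadingIdx K M => √(b q.2.2)) * A)
      ≤ √(∑ k, b k) * frobNorm A := by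
  refine (frobNorm_mul_le _ _).trans (mul_le_mul_of_nonneg_right ?_ (frobNorm_nonneg _))
  refine opNorm_diagonal_le (Real.sqrt_nonneg _) fun q => ?_
  rw [abs_of_nonneg (Real.sqrt_nonneg _)]
  exact Real.sqrt_le_sqrt (Finset.single_le_sum (fun k _ => hb k) (Finset.mem_univ q.2.2))

variable [DecidableEq κ]

/-- The weighted Gram matrix of the rows of `A`, with weights `√(b k)` for user `k` and `v` for the
source coordinates. -/
noncomputable def fadingGram (b : Fin K → ℝ) (v : κ → ℝ) (A : Matrix (FadingIdx K M) κ ℝ) :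
    Matrix (FadingIdx K M) (FadingIdx K M) ℝ :=
  Matrix.diagonal (fun q : FadingIdx K M => √(b q.2.2)) * A * Matrix.diagonal v
    * (Matrix.diagonal (fun q : FadingIdx K M => √(b q.2.2)) * A)ᵀ

/-- The weighted inner products of the rows of `A` and of `B`. -/
noncomputable def fadingNoiseGram (b : Fin K → ℝ) (v : κ → ℝ) (A : Matrix (FadingIdx K M) κ ℝ)
    (B : Matrix (NoiseIdx M) κ ℝ) : Matrix (FadingIdx K M) (NoiseIdx M) ℝ :=
  Matrix.diagonal (fun q : FadingIdx K M => √(b q.2.2)) * A * Matrix.diagonal v * Bᵀ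

theorem fadingGram_apply (b : Fin K → ℝ) (v : κ → ℝ) (A : Matrix (FadingIdx K M) κ ℝ)
    (p q : FadingIdx K M) :
    fadingGram b v A p q = ∑ j, √(b p.2.2) * √(b q.2.2) * A p j * A q j * v j := by
  simp only [fadingGram, Matrix.mul_apply (N := (_ : Matrix _ _ ℝ)ᵀ), Matrix.mul_diagonal,
    Matrix.diagonal_mul, Matrix.transpose_apply]
  exact Finset.sum_congr rfl fun j _ => by ring

theorem fadingNoiseGram_apply (b : Fin K → ℝ) (v : κ → ℝ) (A : Matrix (FadingIdx K M) κ ℝ)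
    (B : Matrix (NoiseIdx M) κ ℝ) (p : FadingIdx K M) (q : NoiseIdx M) :
    fadingNoiseGram b v A B p q = ∑ j, √(b p.2.2) * A p j * B q j * v j := by
  simp only [fadingNoiseGram, Matrix.mul_apply (N := (_ : Matrix _ _ ℝ)ᵀ), Matrix.mul_diagonal,
    Matrix.diagonal_mul, Matrix.transpose_apply]
  exact Finset.sum_congr rfl fun j _ => by ring

variable {b : Fin K → ℝ} {v : κ → ℝ}

theorem opNorm_weighted_mul_diagonal_le (hb : ∀ k, 0 ≤ b k) (hv : ∀ j, |v j| ≤ 1)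
    (A : Matrix (FadingIdx K M) κ ℝ) :
    opNorm (Matrix.diagonal (fun q : FadingIdx K M => √(b q.2.2)) * A * Matrix.diagonal v)
      ≤ √(∑ k, b k) * opNorm A := by
  refine (opNorm_mul_le _ _).trans ?_
  refine (mul_le_mul_of_nonneg_left (opNorm_diagonal_le zero_le_one hv) (opNorm_nonneg _)).trans ?_
  rw [mul_one]
  exact opNorm_weighted_le hb A

theorem opNorm_fadingGram_le (hb : ∀ k, 0 ≤ b k) (hv : ∀ j, |v j| ≤ 1)
    (A : Matrix (FadingIdx K M) κ ℝ) :
    opNorm (fadingGram b v A) ≤ (√(∑ k, b k) * opNorm A) ^ 2 := by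
  refine (opNorm_mul_le _ _).trans ?_
  rw [opNorm_transpose, sq]
  exact mul_le_mul (opNorm_weighted_mul_diagonal_le hb hv A) (opNorm_weighted_le hb A)
    (opNorm_nonneg _) (mul_nonneg (Real.sqrt_nonneg _) (opNorm_nonneg _))

theorem frobNorm_fadingGram_le (hb : ∀ k, 0 ≤ b k) (hv : ∀ j, |v j| ≤ 1)
    (A : Matrix (FadingIdx K M) κ ℝ) :
    frobNorm (fadingGram b v A) ≤ (√(∑ k, b k) * opNorm A) * (√(∑ k, b k) * frobNorm A) := by
  refine (frobNorm_mul_le _ _).trans ?_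
  rw [frobNorm_transpose]
  exact mul_le_mul (opNorm_weighted_mul_diagonal_le hb hv A) (frobNorm_weighted_le hb A)
    (frobNorm_nonneg _) (mul_nonneg (Real.sqrt_nonneg _) (opNorm_nonneg _))

theorem frobNorm_fadingNoiseGram_le (hb : ∀ k, 0 ≤ b k) (hv : ∀ j, |v j| ≤ 1)
    (A : Matrix (FadingIdx K M) κ ℝ) (B : Matrix (NoiseIdx M) κ ℝ) :
    frobNorm (fadingNoiseGram b v A B) ≤ (√(∑ k, b k) * opNorm A) * frobNorm B := by
  refine (frobNorm_mul_le _ _).trans ?_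
  rw [frobNorm_transpose]
  exact mul_le_mul_of_nonneg_right (opNorm_weighted_mul_diagonal_le hb hv A) (frobNorm_nonneg _)

/-- Given the signs, the mean receive energy is a quadratic polynomial in them. Its diagonal part
does not depend on the signs, so that only the off-diagonal and the linear part fluctuate. -/
theorem energy_eq (b : Fin K → ℝ) (v : κ → ℝ) (A : Matrix (FadingIdx K M) κ ℝ)
    (B : Matrix (NoiseIdx M) κ ℝ) (u : Fin K → Fin M → Bool) :
    ∑ j, (∑ p, receiveMatrix b A B u p j ^ 2) * v j
        - (∑ p, fadingGram b v A p p + ∑ p, ∑ j, B p j ^ 2 * v j)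
      = ∑ p : Fin K × Fin M, ∑ q : Fin K × Fin M,
          (fadingBlocks (fadingGram b v A) 0 + fadingBlocks (fadingGram b v A) 1) p q
            * bitSign (u p.1 p.2) * bitSign (u q.1 q.2)
        - ∑ p : Fin K × Fin M,
          (fadingBlocks (fadingGram b v A) 0 + fadingBlocks (fadingGram b v A) 1) p p
            * bitSign (u p.1 p.2) ^ 2
        + 2 * ∑ p : Fin K × Fin M, (fadingNoiseGram b v A B (p.2, 0, p.1) (p.2, 0)
            + fadingNoiseGram b v A B (p.2, 1, p.1) (p.2, 1)) * bitSign (u p.1 p.2) := by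
  set T := fadingGram b v A with hT
  set V := fadingNoiseGram b v A B with hV
  have h1 : ∑ j, (∑ p, receiveMatrix b A B u p j ^ 2) * v j
      = ∑ m, ∑ i, (∑ k, ∑ l, bitSign (u k m) * bitSign (u l m) * T (m, i, k) (m, i, l)
        + 2 * ∑ k, bitSign (u k m) * V (m, i, k) (m, i) + ∑ j, B (m, i) j ^ 2 * v j) := by
    simp_rw [Finset.sum_mul]
    rw [Finset.sum_comm, Fintype.sum_prod_type]
    refine Finset.sum_congr rfl fun m _ => Finset.sum_congr rfl fun i _ => ?_
    have h2 : ∀ j, receiveMatrix b A B u (m, i) j ^ 2 * v j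
        = ∑ k, ∑ l, bitSign (u k m) * bitSign (u l m)
            * (√(b k) * √(b l) * A (m, i, k) j * A (m, i, l) j * v j)
          + 2 * ∑ k, bitSign (u k m) * (√(b k) * A (m, i, k) j * B (m, i) j * v j)
          + B (m, i) j ^ 2 * v j := by
      intro j
      rw [receiveMatrix_apply, add_sq, sq (∑ k, _), Finset.sum_mul_sum, add_mul, add_mul]
      congr 2
      · rw [Finset.sum_mul]
        refine Finset.sum_congr rfl fun k _ => ?_
        rw [Finset.sum_mul]
        exact Finset.sum_congr rfl fun l _ => by ring
      · rw [mul_assoc, mul_assoc, Finset.sum_mul]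
        congr 1
        exact Finset.sum_congr rfl fun k _ => by ring
    simp_rw [h2, Finset.sum_add_distrib, ← Finset.mul_sum]
    congr 2
    · rw [Finset.sum_comm]
      refine Finset.sum_congr rfl fun k _ => ?_
      rw [Finset.sum_comm]
      refine Finset.sum_congr rfl fun l _ => ?_
      rw [hT, fadingGram_apply, Finset.mul_sum]
    · rw [Finset.sum_comm]
      congr 1
      refine Finset.sum_congr rfl fun k _ => ?_
      rw [hV, fadingNoiseGram_apply, Finset.mul_sum]
  have h3 : ∑ p, T p p = ∑ m, ∑ i, ∑ k, T (m, i, k) (m, i, k) := by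
    rw [Fintype.sum_prod_type]
    exact Finset.sum_congr rfl fun m _ => by rw [Fintype.sum_prod_type]
  have h4 : ∑ p : NoiseIdx M, ∑ j, B p j ^ 2 * v j = ∑ m, ∑ i, ∑ j, B (m, i) j ^ 2 * v j := by
    rw [Fintype.sum_prod_type]
  have h5 : ∑ p : Fin K × Fin M, ∑ q : Fin K × Fin M,
      (fadingBlocks T 0 + fadingBlocks T 1) p q * bitSign (u p.1 p.2) * bitSign (u q.1 q.2)
      = ∑ m, ∑ k, ∑ l, (T (m, 0, k) (m, 0, l) + T (m, 1, k) (m, 1, l))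
          * bitSign (u k m) * bitSign (u l m) := by
    rw [Fintype.sum_prod_type, Finset.sum_comm]
    refine Finset.sum_congr rfl fun m _ => Finset.sum_congr rfl fun k _ => ?_
    rw [Fintype.sum_prod_type]
    refine Finset.sum_congr rfl fun l _ => ?_
    rw [Finset.sum_eq_single m]
    · simp [fadingBlocks]
    · intro m' _ hm
      simp [fadingBlocks, Ne.symm hm]
    · simp
  have h6 : ∑ p : Fin K × Fin M,
      (fadingBlocks T 0 + fadingBlocks T 1) p p * bitSign (u p.1 p.2) ^ 2
      = ∑ m, ∑ k, (T (m, 0, k) (m, 0, k) + T (m, 1, k) (m, 1, k)) := by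
    rw [Fintype.sum_prod_type, Finset.sum_comm]
    refine Finset.sum_congr rfl fun m _ => Finset.sum_congr rfl fun k _ => ?_
    rw [bitSign_sq]
    simp [fadingBlocks]
  rw [h1, h3, h4, h5, h6, Fintype.sum_prod_type,
    Finset.sum_comm (f := fun (k : Fin K) (m : Fin M) =>
      (V (m, 0, k) (m, 0) + V (m, 1, k) (m, 1)) * bitSign (u k m)),
    ← Finset.sum_add_distrib, ← Finset.sum_sub_distrib, ← Finset.sum_sub_distrib,
    Finset.mul_sum, ← Finset.sum_add_distrib]
  refine Finset.sum_congr rfl fun m _ => ?_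
  simp only [Fin.sum_univ_two, add_mul, Finset.sum_add_distrib]
  have h7 : ∀ i : Fin 2, ∑ k, ∑ l, bitSign (u k m) * bitSign (u l m) * T (m, i, k) (m, i, l)
      = ∑ k, ∑ l, T (m, i, k) (m, i, l) * bitSign (u k m) * bitSign (u l m) := fun i =>
    Finset.sum_congr rfl fun k _ => Finset.sum_congr rfl fun l _ => by ring
  have h8 : ∀ i : Fin 2, ∑ k, bitSign (u k m) * V (m, i, k) (m, i)
      = ∑ k, V (m, i, k) (m, i) * bitSign (u k m) := fun i =>
    Finset.sum_congr rfl fun k _ => by ring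
  rw [h7, h7, h8, h8]
  ring

/-- The fluctuation of the conditional mean receive energy, caused by the random signs. -/
theorem lintegral_exp_energy_le (hb : ∀ k, 0 ≤ b k) (hv : ∀ j, |v j| ≤ 1)
    (A : Matrix (FadingIdx K M) κ ℝ) (B : Matrix (NoiseIdx M) κ ℝ) {t L F : ℝ}
    (hL : (√(∑ k, b k) * opNorm A) ^ 2 ≤ L) (ht : 16 * |t| * L ≤ 1)
    (hF : ((√(∑ k, b k) * opNorm A) * (√(∑ k, b k) * frobNorm A)) ^ 2
      + ((√(∑ k, b k) * opNorm A) * frobNorm B) ^ 2 ≤ F) :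
    ∫⁻ u, ENNReal.ofReal (Real.exp (t * (∑ j, (∑ p, receiveMatrix b A B u p j ^ 2) * v j
        - (∑ p, fadingGram b v A p p + ∑ p, ∑ j, B p j ^ 2 * v j)))) ∂signLaw K M
      ≤ ENNReal.ofReal (Real.exp (64 / 3 * t ^ 2 * F)) := by
  simp_rw [energy_eq]
  have hop : opNorm (fadingBlocks (fadingGram b v A) 0 + fadingBlocks (fadingGram b v A) 1)
      ≤ 2 * L := by
    refine (opNorm_add_le _ _).trans ?_
    have h1 := (opNorm_fadingGram_le hb hv A).trans hL
    have h2 := opNorm_fadingBlocks_le (fadingGram b v A) 0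
    have h3 := opNorm_fadingBlocks_le (fadingGram b v A) 1
    linarith
  refine (lintegral_exp_chaos_le measurable_sign iIndepFun_sign hasSubgaussianMGF_sign _ _
    ?_).trans ?_
  · have := mul_le_mul_of_nonneg_left hop (abs_nonneg t)
    linarith
  · refine ENNReal.ofReal_le_ofReal (Real.exp_le_exp.2 ?_)
    have h1 := frobNorm_add_fadingBlocks_sq_le (fadingGram b v A)
    have h2 := sum_fadingNoise_sq_le (fadingNoiseGram b v A B)
    have h3 := pow_le_pow_left₀ (frobNorm_nonneg _) (frobNorm_fadingGram_le hb hv A) 2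
    have h4 := pow_le_pow_left₀ (frobNorm_nonneg _) (frobNorm_fadingNoiseGram_le hb hv A B) 2
    have h5 : 32 / 3 * t ^ 2 * (2 * F) = 64 / 3 * t ^ 2 * F := by ring
    rw [← h5]
    refine mul_le_mul_of_nonneg_left ?_ (by positivity)
    linarith

end ReceiveMatrix

/-! ### Exponential moments and tails of the receive energy -/

section ReceiveEnergy

variable {K M : ℕ} {κ : Type*} [Fintype κ] [DecidableEq κ]
  {Ω : Type*} [MeasurableSpace Ω] {μ : Measure Ω} {X : κ → Ω → ℝ}

/-- Exponential moments of the fluctuation of the receive energy. Given the signs it is a centred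
quadratic form in the source vector, whose bound does not depend on the signs; what is left is the
fluctuation of its conditional mean. -/
theorem lintegral_exp_receive_le (hm : ∀ j, Measurable (X j))
    (hind : iIndepFun X μ) (hX : ∀ j, HasSubgaussianMGF (X j) 1 μ)
    (hv : ∀ j, |∫ ω, X j ω ^ 2 ∂μ| ≤ 1)
    {b : Fin K → ℝ} (hb : ∀ k, 0 ≤ b k) {d : ℝ} (hd : ∑ k, b k ≤ d)
    (A : Matrix (FadingIdx K M) κ ℝ) (B : Matrix (NoiseIdx M) κ ℝ) {t : ℝ}
    (ht : 16 * |t| * (√d * opNorm A + opNorm B) ^ 2 ≤ 1) :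
    ∫⁻ p : Ω × (Fin K → Fin M → Bool), ENNReal.ofReal (Real.exp (t *
        (∑ i, (receiveMatrix b A B p.2 *ᵥ fun j => X j p.1) i ^ 2
          - (∑ q, fadingGram b (fun j => ∫ ω, X j ω ^ 2 ∂μ) A q q
            + ∑ q, ∑ j, B q j ^ 2 * ∫ ω, X j ω ^ 2 ∂μ)))) ∂μ.prod (signLaw K M)
      ≤ ENNReal.ofReal (Real.exp (64 * t ^ 2 * ((√d * opNorm A + opNorm B) ^ 2
          * (√d * frobNorm A + frobNorm B) ^ 2))) := by
  have : IsProbabilityMeasure μ := hind.isProbabilityMeasure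
  set v : κ → ℝ := fun j => ∫ ω, X j ω ^ 2 ∂μ with hvdef
  set c : ℝ := ∑ q, fadingGram b v A q q + ∑ q, ∑ j, B q j ^ 2 * v j with hc
  set l : ℝ := √d * opNorm A + opNorm B with hl
  set r : ℝ := √d * frobNorm A + frobNorm B with hr
  have hoA := opNorm_nonneg A
  have hoB := opNorm_nonneg B
  have hfA := frobNorm_nonneg A
  have hfB := frobNorm_nonneg B
  have hsd := Real.sqrt_le_sqrt hd
  have hs0 := Real.sqrt_nonneg (∑ k, b k)
  have hopC : ∀ u, opNorm (receiveMatrix b A B u) ≤ l := fun u =>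
    (opNorm_receiveMatrix_le hb A B u).trans
      (add_le_add_left (mul_le_mul_of_nonneg_right hsd hoA) _)
  have hfrC : ∀ u, frobNorm (receiveMatrix b A B u) ≤ r := fun u =>
    (frobNorm_receiveMatrix_le hb A B u).trans
      (add_le_add_left (mul_le_mul_of_nonneg_right hsd hfA) _)
  have hmeas : Measurable fun p : Ω × (Fin K → Fin M → Bool) => ENNReal.ofReal (Real.exp (t *
        (∑ i, (receiveMatrix b A B p.2 *ᵥ fun j => X j p.1) i ^ 2 - c))) := by
    have h1 : ∀ i j, Measurable fun p : Ω × (Fin K → Fin M → Bool) =>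
        receiveMatrix b A B p.2 i j := fun i j =>
      (measurable_of_finite fun u => receiveMatrix b A B u i j).comp measurable_snd
    simp only [Matrix.mulVec, dotProduct]
    fun_prop
  rw [lintegral_prod_symm' _ hmeas]
  have hinner : ∀ u, ∫⁻ ω, ENNReal.ofReal (Real.exp (t *
        (∑ i, (receiveMatrix b A B u *ᵥ fun j => X j ω) i ^ 2 - c))) ∂μ
      ≤ ENNReal.ofReal (Real.exp (128 / 3 * t ^ 2 * (l ^ 2 * r ^ 2))) *
        ENNReal.ofReal (Real.exp (t * (∑ j, (∑ p, receiveMatrix b A B u p j ^ 2) * v j - c))) := by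
    intro u
    have h1 : ∀ ω, ENNReal.ofReal (Real.exp (t *
        (∑ i, (receiveMatrix b A B u *ᵥ fun j => X j ω) i ^ 2 - c)))
        = ENNReal.ofReal (Real.exp (t * (∑ i, (receiveMatrix b A B u *ᵥ fun j => X j ω) i ^ 2
            - ∑ j, (∑ p, receiveMatrix b A B u p j ^ 2) * v j))) *
          ENNReal.ofReal (Real.exp
            (t * (∑ j, (∑ p, receiveMatrix b A B u p j ^ 2) * v j - c))) := by
      intro ω
      rw [← ENNReal.ofReal_mul (Real.exp_pos _).le, ← Real.exp_add]
      ring_nf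
    rw [lintegral_congr h1, lintegral_mul_const' _ _ ENNReal.ofReal_ne_top]
    refine mul_le_mul_left ((lintegral_exp_sum_mulVec_sq_sub_le hm hind hX _ ?_).trans ?_) _
    · refine le_trans ?_ ht
      exact mul_le_mul_of_nonneg_left (pow_le_pow_left₀ (opNorm_nonneg _) (hopC u) 2)
        (by positivity)
    · refine ENNReal.ofReal_le_ofReal (Real.exp_le_exp.2 ?_)
      refine mul_le_mul_of_nonneg_left ?_ (by positivity)
      exact mul_le_mul (pow_le_pow_left₀ (opNorm_nonneg _) (hopC u) 2)
        (pow_le_pow_left₀ (frobNorm_nonneg _) (hfrC u) 2) (sq_nonneg _) (sq_nonneg _)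
  refine (lintegral_mono hinner).trans ?_
  rw [lintegral_const_mul' _ _ ENNReal.ofReal_ne_top]
  have hsl : √(∑ k, b k) * opNorm A ≤ l := by
    have := mul_le_mul_of_nonneg_right hsd hoA
    linarith
  have hsl0 : 0 ≤ √(∑ k, b k) * opNorm A := mul_nonneg hs0 hoA
  have hsr : √(∑ k, b k) * frobNorm A ≤ √d * frobNorm A := mul_le_mul_of_nonneg_right hsd hfA
  have hsr0 : 0 ≤ √(∑ k, b k) * frobNorm A := mul_nonneg hs0 hfA
  have hsl2 : (√(∑ k, b k) * opNorm A) ^ 2 ≤ l ^ 2 := pow_le_pow_left₀ hsl0 hsl 2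
  refine (mul_le_mul_right (lintegral_exp_energy_le (F := l ^ 2 * r ^ 2) hb hv A B hsl2 ht ?_)
    _).trans_eq ?_
  · rw [mul_pow, mul_pow _ (frobNorm B), ← mul_add]
    refine mul_le_mul hsl2 ?_ (by positivity) (sq_nonneg _)
    rw [hr]
    nlinarith
  · rw [← ENNReal.ofReal_mul (Real.exp_pos _).le, ← Real.exp_add]
    ring_nf

end ReceiveEnergy

section Moments

variable {Ω : Type*} [MeasurableSpace Ω] {μ : Measure Ω}

/-- The infimum in the sub-Gaussian norm is attained, by continuity in the variance proxy. -/
theorem hasSubgaussianMGF_of_subGaussNorm_le_one {X : Ω → ℝ} (h : subGaussNorm X μ ≤ 1) :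
    HasSubgaussianMGF (fun ω => X ω - μ[X]) 1 μ := by
  have key : ∀ δ : ℝ, 0 < δ → ∃ t : ℝ≥0, (t : ℝ) < 1 + δ ∧
      HasSubgaussianMGF (fun ω => X ω - μ[X]) (t ^ 2) μ := by
    intro δ hδ
    have h1 : subGaussNorm X μ < ENNReal.ofReal (1 + δ) :=
      h.trans_lt (by rw [ENNReal.one_lt_ofReal]; linarith)
    simp only [subGaussNorm, iInf_lt_iff] at h1
    obtain ⟨t, ⟨_, ht⟩, hlt⟩ := h1
    refine ⟨t, ?_, ht⟩
    rw [← ENNReal.ofReal_coe_nnreal, ENNReal.ofReal_lt_ofReal_iff (by linarith)] at hlt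
    exact hlt
  refine ⟨fun s => ?_, fun s => ?_⟩
  · obtain ⟨t, -, ht⟩ := key 1 one_pos
    exact ht.integrable_exp_mul s
  · have hlim : Filter.Tendsto (fun δ : ℝ => Real.exp ((1 + δ) ^ 2 * s ^ 2 / 2))
        (nhdsWithin 0 (Set.Ioi 0)) (nhds (Real.exp ((1 + 0) ^ 2 * s ^ 2 / 2))) :=
      (Continuous.tendsto (by fun_prop) 0).mono_left nhdsWithin_le_nhds
    have h2 := ge_of_tendsto hlim (b := mgf (fun ω => X ω - μ[X]) μ s) (by
      filter_upwards [self_mem_nhdsWithin] with δ hδ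
      obtain ⟨t, ht1, ht⟩ := key δ hδ
      refine (ht.mgf_le s).trans (Real.exp_le_exp.2 ?_)
      push_cast
      have := pow_le_pow_left₀ t.2 ht1.le 2
      gcongr)
    simpa using h2

theorem one_add_sq_div_two_le_cosh (x : ℝ) : 1 + x ^ 2 / 2 ≤ Real.cosh x := by
  have h := sum_le_hasSum (Finset.range 2) (fun n _ => by rw [pow_mul]; positivity)
    (Real.hasSum_cosh x)
  simpa [Finset.sum_range_succ, Nat.factorial] using h

/-- The variance of a sub-Gaussian variable is at most its variance proxy. -/
theorem integral_sq_le_one [IsProbabilityMeasure μ] {X : Ω → ℝ} (hX : HasSubgaussianMGF X 1 μ) :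
    ∫ ω, X ω ^ 2 ∂μ ≤ 1 := by
  have hsq : Integrable (fun ω => X ω ^ 2) μ := (hX.memLp 2).integrable_sq
  refine le_of_forall_pos_le_add fun δ hδ => ?_
  -- with `y = c² / 2`, comparing `E cosh (c X)` with `exp y` gives `E X² ≤ 1 + y`
  set y : ℝ := min δ 1 with hy
  have hy0 : 0 < y := lt_min hδ one_pos
  set c : ℝ := √(2 * y) with hc
  have hc2 : c ^ 2 = 2 * y := Real.sq_sqrt (by positivity)
  have h1 : ∫ ω, (2 + 2 * y * X ω ^ 2) ∂μ
      ≤ ∫ ω, (Real.exp (c * X ω) + Real.exp (-c * X ω)) ∂μ := by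
    refine integral_mono ((integrable_const _).add (hsq.const_mul _))
      ((hX.integrable_exp_mul c).add (hX.integrable_exp_mul (-c))) fun ω => ?_
    have h := one_add_sq_div_two_le_cosh (c * X ω)
    rw [Real.cosh_eq, mul_pow, hc2, ← neg_mul] at h
    simp only
    linarith
  rw [integral_add (integrable_const _) (hsq.const_mul _), integral_const_mul,
    integral_add (hX.integrable_exp_mul c) (hX.integrable_exp_mul (-c))] at h1
  have h2 := hX.mgf_le c
  have h3 := hX.mgf_le (-c)
  have h4 : Real.exp (((1 : ℝ≥0) : ℝ) * c ^ 2 / 2) = Real.exp y := by rw [hc2]; simp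
  rw [neg_sq, h4] at h3
  rw [h4] at h2
  simp only [mgf] at h2 h3
  have h5 := (abs_le.1 (Real.abs_exp_sub_one_sub_id_le (x := y)
    (by rw [abs_of_pos hy0]; exact min_le_right _ _))).2
  simp only [integral_const, probReal_univ, smul_eq_mul, one_mul] at h1
  have h6 : y * ∫ ω, X ω ^ 2 ∂μ ≤ y * (1 + y) := by nlinarith
  have h7 := le_of_mul_le_mul_left h6 hy0
  have h8 : y ≤ δ := min_le_left _ _
  linarith

/-- Chernoff's bound for both tails. -/
theorem measureReal_abs_ge_le [IsProbabilityMeasure μ] {Q : Ω → ℝ} {q t E : ℝ} (ht : 0 ≤ t)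
    (hpos : ∫⁻ ω, ENNReal.ofReal (Real.exp (t * Q ω)) ∂μ ≤ ENNReal.ofReal (Real.exp E))
    (hneg : ∫⁻ ω, ENNReal.ofReal (Real.exp (-t * Q ω)) ∂μ ≤ ENNReal.ofReal (Real.exp E))
    (hm : Measurable Q) : μ.real {ω | q ≤ |Q ω|} ≤ 2 * Real.exp (E - t * q) := by
  have key : ∀ s : ℝ, ∫⁻ ω, ENNReal.ofReal (Real.exp (s * Q ω)) ∂μ ≤ ENNReal.ofReal (Real.exp E) →
      μ.real {ω | t * q ≤ s * Q ω} ≤ Real.exp (E - t * q) := by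
    intro s hs
    have h1 := mul_meas_ge_le_lintegral (μ := μ)
      (f := fun ω => ENNReal.ofReal (Real.exp (s * Q ω))) (by fun_prop)
      (ENNReal.ofReal (Real.exp (t * q)))
    have h2 : {ω | ENNReal.ofReal (Real.exp (t * q)) ≤ ENNReal.ofReal (Real.exp (s * Q ω))}
        = {ω | t * q ≤ s * Q ω} := by
      ext ω
      simp [ENNReal.ofReal_le_ofReal_iff (Real.exp_pos _).le]
    rw [h2] at h1
    have h3 := ENNReal.toReal_mono ENNReal.ofReal_ne_top (h1.trans hs)
    rw [ENNReal.toReal_mul, ENNReal.toReal_ofReal (Real.exp_pos _).le,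
      ENNReal.toReal_ofReal (Real.exp_pos _).le] at h3
    rw [Real.exp_sub, le_div_iff₀' (Real.exp_pos _)]
    exact h3
  have hsub : {ω | q ≤ |Q ω|} ⊆ {ω | t * q ≤ t * Q ω} ∪ {ω | t * q ≤ -t * Q ω} := by
    intro ω (hω : q ≤ |Q ω|)
    rcases le_abs.1 hω with h | h
    · exact Or.inl (mul_le_mul_of_nonneg_left h ht)
    · refine Or.inr ?_
      have := mul_le_mul_of_nonneg_left h ht
      simp only [Set.mem_ofPred_eq]
      linarith
  calc μ.real {ω | q ≤ |Q ω|} ≤ μ.real {ω | t * q ≤ t * Q ω} + μ.real {ω | t * q ≤ -t * Q ω} :=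
        (measureReal_mono hsub).trans (measureReal_union_le _ _)
    _ ≤ _ := by
        have := key t hpos
        have := key (-t) hneg
        linarith

end Moments

/-! ### Extension of the outer function -/

section Extension

/-- A measurable function on a measurable set of reals extends to all of `ℝ` so that its increments
between an arbitrary point and a point of the set are dominated at twice the distance (which cannot
be improved, since `Φ` need not be subadditive). Off the set, the extension is the limit for `δ → 0`
of the supremum of the values at the points which are nearest up to `δ`. -/
theorem exists_measurable_extension {D : Set ℝ} (hD : MeasurableSet D) {F : D → ℝ}
    (hF : Measurable F) {Φ : ℝ → ℝ} (hΦ : StrictMonoOn Φ (Set.Ici 0))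
    (hinc : ∀ x y : D, |F x - F y| ≤ Φ |(x : ℝ) - y|) :
    ∃ G : ℝ → ℝ, Measurable G ∧ (∀ x : D, G x = F x) ∧
      ∀ (x : ℝ) (y : D) (δ : ℝ), 0 < δ → |G x - F y| ≤ Φ (2 * |x - y| + δ) := by
  classical
  rcases D.eq_empty_or_nonempty with rfl | hne
  · exact ⟨0, measurable_const, fun x => x.2.elim, fun _ y => y.2.elim⟩
  set e : ℕ → ℝ := fun n => 1 / ((n : ℝ) + 1) with he
  have he0 : ∀ n, 0 < e n := fun n => Nat.one_div_pos_of_nat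
  set near : ℕ → ℝ → Set ℝ := fun n x =>
    F '' {y : D | dist x y < Metric.infDist x D + e n} with hnear
  have hmono : ∀ {a b : ℝ}, 0 ≤ a → a ≤ b → Φ a ≤ Φ b := fun ha hab =>
    hΦ.monotoneOn ha (ha.trans hab) hab
  have hdist : ∀ (x : ℝ) (y z : D) (δ : ℝ), dist x z < Metric.infDist x D + δ →
      |F z - F y| ≤ Φ (2 * |x - y| + δ) := by
    intro x y z δ hz
    refine (hinc z y).trans (hmono (abs_nonneg _) ?_)
    have h1 : Metric.infDist x D ≤ dist x y := Metric.infDist_le_dist_of_mem y.2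
    have h2 : dist (z : ℝ) y ≤ dist x z + dist x y := dist_triangle_left _ _ _
    rw [Real.dist_eq] at h2
    rw [Real.dist_eq x y] at h1 h2
    linarith
  have hex : ∀ (x : ℝ) (δ : ℝ), 0 < δ → ∃ z : D, dist x z < Metric.infDist x D + δ := by
    intro x δ hδ
    obtain ⟨z, hz, hlt⟩ := (Metric.infDist_lt_iff hne).1
      (lt_add_of_pos_right (Metric.infDist x D) hδ)
    exact ⟨⟨z, hz⟩, hlt⟩
  obtain ⟨y₀, hy₀⟩ := hne
  have hbdd : ∀ n x, BddAbove (near n x) := by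
    intro n x
    refine ⟨F ⟨y₀, hy₀⟩ + Φ (2 * |x - y₀| + e n), ?_⟩
    rintro _ ⟨z, hz, rfl⟩
    have := (abs_le.1 (hdist x ⟨y₀, hy₀⟩ z (e n) hz)).2
    simp only at this
    linarith
  have hnon : ∀ n x, (near n x).Nonempty := fun n x =>
    let ⟨z, hz⟩ := hex x (e n) (he0 n)
    ⟨F z, z, hz, rfl⟩
  set H : ℝ → ℝ := fun x => ⨅ n, sSup (near n x) with hH
  have hlow : ∀ (x : ℝ) (y : D) (δ : ℝ), 0 < δ → ∀ n,
      F y - Φ (2 * |x - y| + δ) ≤ sSup (near n x) := by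
    intro x y δ hδ n
    obtain ⟨z, hz⟩ := hex x (min (e n) δ) (lt_min (he0 n) hδ)
    have h1 : F z ≤ sSup (near n x) := le_csSup (hbdd n x)
      ⟨z, hz.trans_le (add_le_add_right (min_le_left _ _) _), rfl⟩
    have h2 := (abs_le.1 (hdist x y z δ (hz.trans_le (add_le_add_right (min_le_right _ _) _)))).1
    linarith
  have hHm : Measurable H := by
    refine Measurable.iInf fun n => measurable_of_Ioi fun c => IsOpen.measurableSet ?_
    have h1 : (fun x => sSup (near n x)) ⁻¹' Set.Ioi c
        = ⋃ y : {y : D // c < F y}, {x : ℝ | dist x y.1 < Metric.infDist x D + e n} := by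
      ext x
      simp only [Set.mem_preimage, Set.mem_Ioi, lt_csSup_iff (hbdd n x) (hnon n x), Set.mem_iUnion,
        Set.mem_ofPred_eq]
      constructor
      · rintro ⟨_, ⟨y, hy, rfl⟩, hc⟩
        exact ⟨⟨y, hc⟩, hy⟩
      · rintro ⟨⟨y, hc⟩, hy⟩
        exact ⟨F y, ⟨y, hy, rfl⟩, hc⟩
    rw [h1]
    exact isOpen_iUnion fun y => isOpen_lt (by fun_prop)
      ((Metric.continuous_infDist_pt D).add continuous_const)
  refine ⟨fun x => if h : x ∈ D then F ⟨x, h⟩ else H x, ?_, fun x => by simp, ?_⟩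
  · refine measurable_of_restrict_of_restrict_compl hD ?_ ?_
    · convert hF using 1
      ext x
      simp
    · convert hHm.comp measurable_subtype_coe using 1
      ext x
      simp only [Set.domRestrict_apply, Function.comp_apply]
      rw [dif_neg x.2]
  · intro x y δ hδ
    by_cases hx : x ∈ D
    · simp only [hx, dif_pos]
      refine (hinc ⟨x, hx⟩ y).trans (hmono (abs_nonneg _) ?_)
      have := abs_nonneg (x - y)
      simp only
      linarith
    · simp only [hx, dif_neg, not_false_eq_true]
      obtain ⟨n, hn⟩ := exists_nat_one_div_lt hδ
      rw [abs_le]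
      constructor
      · have := le_ciInf (hlow x y δ hδ)
        simp only [hH]
        linarith
      · have h1 : H x ≤ sSup (near n x) :=
          ciInf_le ⟨_, by rintro _ ⟨n, rfl⟩; exact hlow x y δ hδ n⟩ n
        have h2 : sSup (near n x) ≤ F y + Φ (2 * |x - y| + δ) := by
          refine csSup_le (hnon n x) ?_
          rintro _ ⟨z, hz, rfl⟩
          have := (abs_le.1 (hdist x y z δ (lt_trans hz (add_lt_add_right hn _)))).2
          linarith
        linarith

end Extension

/-! ### The channel and the scheme -/

section Channel

variable {K M : ℕ} {Ω : Type*} [MeasurableSpace Ω] {μ : Measure Ω}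
  {R : SourceIdx K M → Ω → ℝ} {A : Matrix (FadingIdx K M) (SourceIdx K M) ℝ}
  {B : Matrix (NoiseIdx M) (SourceIdx K M) ℝ}

/-- A mixture with mean zero does not change if the sources are centred. -/
theorem mixed_eq_mulVec_sub {ι κ : Type*} [Fintype κ] {C : Matrix ι κ ℝ} {R : κ → Ω → ℝ}
    (hR : ∀ j, Integrable (R j) μ) {i : ι} (h0 : μ[mixed C R i] = 0) (ω : Ω) :
    mixed C R i ω = (C *ᵥ fun j => R j ω - μ[R j]) i := by
  have h1 : μ[mixed C R i] = ∑ j, C i j * μ[R j] := by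
    simp only [mixed, Matrix.mulVec, dotProduct]
    rw [integral_finsetSum _ fun j _ => (hR j).const_mul _]
    exact Finset.sum_congr rfl fun j _ => integral_const_mul _ _
  rw [h0] at h1
  simp only [mixed, Matrix.mulVec, dotProduct, mul_sub, Finset.sum_sub_distrib]
  rw [← h1, sub_zero]

theorem variance_mixed {ι κ : Type*} [Fintype κ] (C : Matrix ι κ ℝ) {R : κ → Ω → ℝ}
    (hR : ∀ j, MemLp (R j) 2 μ) (hind : iIndepFun R μ) (i : ι) :
    Var[mixed C R i; μ] = ∑ j, C i j ^ 2 * ∫ ω, (R j ω - μ[R j]) ^ 2 ∂μ := by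
  have h1 : mixed C R i = ∑ j, fun ω => C i j * R j ω := by
    ext ω
    simp [mixed, Matrix.mulVec, dotProduct, Finset.sum_apply]
  rw [h1, IndepFun.variance_sum (fun j _ => (hR j).const_mul (C i j)) fun j _ k _ hjk =>
    (hind.indepFun hjk).comp (measurable_const_mul _) (measurable_const_mul _)]
  refine Finset.sum_congr rfl fun j _ => ?_
  rw [variance_const_mul, variance_eq_integral (hR j).aemeasurable]

theorem IsCorrelatedChannel.hasSubgaussianMGF (h : IsCorrelatedChannel μ R A B)
    (j : SourceIdx K M) : HasSubgaussianMGF (fun ω => R j ω - μ[R j]) 1 μ :=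
  hasSubgaussianMGF_of_subGaussNorm_le_one (h.subGauss j)

theorem IsCorrelatedChannel.memLp (h : IsCorrelatedChannel μ R A B) (j : SourceIdx K M) :
    MemLp (R j) 2 μ := by
  have : IsProbabilityMeasure μ := h.indep.isProbabilityMeasure
  have h1 := ((h.hasSubgaussianMGF j).memLp 2).add (memLp_const (μ[R j]))
  refine (memLp_congr_ae (ae_of_all _ fun ω => ?_)).1 h1
  simp

theorem IsCorrelatedChannel.integrable (h : IsCorrelatedChannel μ R A B) (j : SourceIdx K M) :
    Integrable (R j) μ := by
  have : IsProbabilityMeasure μ := h.indep.isProbabilityMeasure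
  exact (h.memLp j).integrable one_le_two

theorem IsCorrelatedChannel.noiseEnergy_eq (h : IsCorrelatedChannel μ R A B) :
    noiseEnergy μ B R = ∑ q, ∑ j, B q j ^ 2 * ∫ ω, (R j ω - μ[R j]) ^ 2 ∂μ := by
  have : IsProbabilityMeasure μ := h.indep.isProbabilityMeasure
  have hm : ∀ q, MemLp (mixed B R q) 2 μ := by
    intro q
    have h1 : mixed B R q = fun ω => ∑ j, B q j * R j ω := rfl
    rw [h1]
    exact memLp_finsetSum _ fun j _ => (h.memLp j).const_mul _
  have h1 : ∀ ω, ∑ m, ‖noise B R m ω‖ ^ 2 = ∑ q, mixed B R q ω ^ 2 := by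
    intro ω
    rw [Fintype.sum_prod_type]
    refine Finset.sum_congr rfl fun m _ => ?_
    rw [Fin.sum_univ_two, Complex.sq_norm, Complex.normSq_apply]
    simp only [noise]
    ring
  rw [noiseEnergy]
  simp_rw [h1]
  rw [integral_finsetSum _ fun q _ => (hm q).integrable_sq]
  refine Finset.sum_congr rfl fun q _ => ?_
  rw [← variance_mixed B h.memLp h.indep q,
    variance_of_integral_eq_zero (hm q).aemeasurable (h.noise_mean q)]

/-- The mean receive energy of the signal: the fading coefficients have variance one, so that user
`k` contributes its power `a k` in each of the two real dimensions of each channel use. -/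
theorem IsCorrelatedChannel.sum_fadingGram (h : IsCorrelatedChannel μ R A B) {a : Fin K → ℝ}
    (ha : ∀ k, 0 ≤ a k) :
    ∑ q, fadingGram a (fun j => ∫ ω, (R j ω - μ[R j]) ^ 2 ∂μ) A q q = 2 * M * ∑ k, a k := by
  have h1 : ∀ q : FadingIdx K M,
      fadingGram a (fun j => ∫ ω, (R j ω - μ[R j]) ^ 2 ∂μ) A q q = a q.2.2 := by
    intro q
    have hvar := h.fading_variance q
    rw [variance_mixed A h.memLp h.indep q] at hvar
    rw [fadingGram_apply, ← mul_one (a q.2.2)]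
    nth_rw 3 [← hvar]
    rw [Finset.mul_sum]
    refine Finset.sum_congr rfl fun j _ => ?_
    rw [mul_one, Real.mul_self_sqrt (ha _)]
    ring
  simp_rw [h1]
  rw [Fintype.sum_prod_type]
  simp only [Fintype.sum_prod_type, Finset.sum_const, Finset.card_univ, Fintype.card_fin,
    nsmul_eq_mul]
  push_cast
  ring

theorem IsCorrelatedChannel.sum_norm_channelOutput_sq (h : IsCorrelatedChannel μ R A B)
    (a : Fin K → ℝ) (u : Fin K → Fin M → Bool) (ω : Ω) :
    ∑ m, ‖channelOutput A B R (fun k m => ((√(a k) * bitSign (u k m) : ℝ) : ℂ)) ω m‖ ^ 2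
      = ∑ q, (receiveMatrix a A B u *ᵥ fun j => R j ω - μ[R j]) q ^ 2 := by
  rw [Fintype.sum_prod_type]
  refine Finset.sum_congr rfl fun m _ => ?_
  have h1 : ∀ i : Fin 2, (receiveMatrix a A B u *ᵥ fun j => R j ω - μ[R j]) (m, i)
      = ∑ k, √(a k) * bitSign (u k m) * mixed A R (m, i, k) ω + mixed B R (m, i) ω := by
    intro i
    rw [receiveMatrix, Matrix.add_mulVec, ← Matrix.mulVec_mulVec, Pi.add_apply,
      ← mixed_eq_mulVec_sub h.integrable (h.noise_mean _)]
    congr 1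
    have h2 : (A *ᵥ fun j => R j ω - μ[R j]) = fun q => mixed A R q ω := by
      ext q
      rw [mixed_eq_mulVec_sub h.integrable (h.fading_mean q)]
    rw [h2]
    exact sum_signMatrix_mul a (fun k m => bitSign (u k m)) (fun q => mixed A R q ω) m i
  rw [Fin.sum_univ_two, h1, h1, Complex.sq_norm, Complex.normSq_apply, ← sq, ← sq]
  congr 2
  · simp only [channelOutput, fading, noise, Complex.add_re, Complex.re_sum, Complex.re_mul_ofReal]
    congr 1
    exact Finset.sum_congr rfl fun k _ => mul_comm _ _
  · simp only [channelOutput, fading, noise, Complex.add_im, Complex.im_sum, Complex.im_mul_ofReal]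
    congr 1
    exact Finset.sum_congr rfl fun k _ => mul_comm _ _

end Channel

section Scheme

variable {K : ℕ} {S : Fin K → Set ℝ} {f : (∀ k, S k) → ℝ}

namespace NomographicRep

theorem sum_power_le (r : NomographicRep S f) {P : ℝ} (hP : 0 ≤ P) (hΔ : 0 ≤ r.maxSpread)
    (s : ∀ k, S k) : ∑ k, r.power P k (s k) ≤ P / r.maxSpread * r.totalSpread := by
  rw [totalSpread, Finset.mul_sum]
  refine Finset.sum_le_sum fun k _ => ?_
  obtain ⟨C, hC⟩ := r.inner_bounded k
  have h2 : r.inner k (s k) ≤ r.phiMax k :=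
    le_ciSup ⟨C, by rintro _ ⟨s, rfl⟩; exact (abs_le.1 (hC s)).2⟩ (s k)
  exact mul_le_mul_of_nonneg_left (by linarith) (div_nonneg hP hΔ)

/-- The rescaled receive energy deviates from the sum of the inner functions by a multiple of the
deviation of the receive energy from its mean. -/
theorem rescale_sub_sum (r : NomographicRep S f) (hΔ : 0 < r.maxSpread) {P : ℝ} (hP : 0 < P)
    {M : ℕ} (hM : 0 < M) (s : ∀ k, S k) (y : ℝ) :
    r.rescale M P y - ∑ k, r.inner k (s k)
      = r.maxSpread / (2 * M * P) * (y - 2 * M * ∑ k, r.power P k (s k)) := by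
  have hM' : (M : ℝ) ≠ 0 := by exact_mod_cast hM.ne'
  simp only [rescale, power, ← Finset.mul_sum, Finset.sum_sub_distrib]
  field_simp
  ring

end NomographicRep

variable {M : ℕ}

/-- The bound for the operator norm of the receive matrix, in terms of the constant `L`. -/
theorem sq_add_opNorm_eq (r : NomographicRep S f) (hΔ : 0 < r.maxSpread)
    {P : ℝ} (hP : 0 < P) (A : Matrix (FadingIdx K M) (SourceIdx K M) ℝ)
    (B : Matrix (NoiseIdx M) (SourceIdx K M) ℝ) :
    (√(P / r.maxSpread * r.totalSpread) * opNorm A + opNorm B) ^ 2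
      = P / r.maxSpread * constL r P A B := by
  have h0 : 0 < P / r.maxSpread := div_pos hP hΔ
  have h1 : √(P / r.maxSpread) * √(r.maxSpread / P) = 1 := by
    rw [← Real.sqrt_mul h0.le]
    have : P / r.maxSpread * (r.maxSpread / P) = 1 := by field_simp
    rw [this, Real.sqrt_one]
  calc _ = (√(P / r.maxSpread) * (√r.totalSpread * opNorm A)
        + (√(P / r.maxSpread) * √(r.maxSpread / P)) * opNorm B) ^ 2 := by
        rw [Real.sqrt_mul h0.le, h1]; ring
    _ = √(P / r.maxSpread) ^ 2 * constL r P A B := by rw [constL]; ring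
    _ = _ := by rw [Real.sq_sqrt h0.le]

/-- The bound for the Frobenius norm of the receive matrix, in terms of the second factor of the
constant `F`. -/
theorem sq_add_frobNorm_eq (r : NomographicRep S f) (hΔ : 0 < r.maxSpread)
    {P : ℝ} (hP : 0 < P) (hM : 0 < M) (A : Matrix (FadingIdx K M) (SourceIdx K M) ℝ)
    (B : Matrix (NoiseIdx M) (SourceIdx K M) ℝ) :
    (√(P / r.maxSpread * r.totalSpread) * frobNorm A + frobNorm B) ^ 2
      = P / r.maxSpread * M * (√(r.totalSpread / M) * frobNorm A
          + √(r.maxSpread / (P * M)) * frobNorm B) ^ 2 := by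
  have hM' : 0 < (M : ℝ) := by exact_mod_cast hM
  have h0 : 0 < P / r.maxSpread * M := mul_pos (div_pos hP hΔ) hM'
  have h1 : √(P / r.maxSpread * M) * √(r.maxSpread / (P * M)) = 1 := by
    rw [← Real.sqrt_mul h0.le]
    have : P / r.maxSpread * M * (r.maxSpread / (P * M)) = 1 := by field_simp
    rw [this, Real.sqrt_one]
  have h2 : √(P / r.maxSpread * M) * √(r.totalSpread / M)
      = √(P / r.maxSpread * r.totalSpread) := by
    rw [← Real.sqrt_mul h0.le]
    congr 1
    field_simp
  calc _ = ((√(P / r.maxSpread * M) * √(r.totalSpread / M)) * frobNorm A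
        + (√(P / r.maxSpread * M) * √(r.maxSpread / (P * M))) * frobNorm B) ^ 2 := by
        rw [h1, h2]; ring
    _ = √(P / r.maxSpread * M) ^ 2 * (√(r.totalSpread / M) * frobNorm A
          + √(r.maxSpread / (P * M)) * frobNorm B) ^ 2 := by ring
    _ = _ := by rw [Real.sq_sqrt h0.le]

/-- The tail of the deviation of the argument of the outer function from its true value. -/
theorem measureReal_rescale_ge_le (r : NomographicRep S f) (hΔ : 0 < r.maxSpread) (hM : 0 < M)
    {P : ℝ} (hP : 0 < P) {Ω : Type*} [MeasurableSpace Ω] {μ : Measure Ω} [IsProbabilityMeasure μ]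
    {R : SourceIdx K M → Ω → ℝ} {A : Matrix (FadingIdx K M) (SourceIdx K M) ℝ}
    {B : Matrix (NoiseIdx M) (SourceIdx K M) ℝ} (h : IsCorrelatedChannel μ R A B)
    (s : ∀ k, S k) {τ : ℝ} (hτ : 0 ≤ τ) :
    (μ.prod (signLaw K M)).real {p | τ ≤ |r.rescale M P (∑ m, ‖channelOutput A B R (fun k m =>
        ((√(r.power P k (s k)) * bitSign (p.2 k m) : ℝ) : ℂ)) p.1 m‖ ^ 2 - noiseEnergy μ B R)
        - ∑ k, r.inner k (s k)|}
      ≤ 2 * Real.exp (-(M * τ ^ 2 / (64 * constF r P A B + 16 * τ * constL r P A B))) := by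
  set a : Fin K → ℝ := fun k => r.power P k (s k) with ha
  have ha0 : ∀ k, 0 ≤ a k := fun k => (r.power_le hP.le k (s k)).1
  set X : SourceIdx K M → Ω → ℝ := fun j ω => R j ω - μ[R j] with hX
  have hXm : ∀ j, Measurable (X j) := fun j => (h.measurable j).sub_const _
  have hXi : iIndepFun X μ := by
    have h1 : ∀ j, Measurable fun x : ℝ => x - μ[R j] := fun j => by fun_prop
    exact h.indep.comp _ h1
  have hv : ∀ j, |∫ ω, X j ω ^ 2 ∂μ| ≤ 1 := fun j => by
    rw [abs_of_nonneg (integral_nonneg fun _ => sq_nonneg _)]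
    exact integral_sq_le_one (h.hasSubgaussianMGF j)
  set c : ℝ := ∑ q, fadingGram a (fun j => ∫ ω, X j ω ^ 2 ∂μ) A q q
    + ∑ q, ∑ j, B q j ^ 2 * ∫ ω, X j ω ^ 2 ∂μ with hc
  have hc' : c = 2 * M * ∑ k, a k + noiseEnergy μ B R := by
    rw [hc, h.sum_fadingGram ha0, h.noiseEnergy_eq]
  set Q : Ω × (Fin K → Fin M → Bool) → ℝ := fun p =>
    ∑ i, (receiveMatrix a A B p.2 *ᵥ fun j => X j p.1) i ^ 2 - c with hQ
  have hM' : 0 < (M : ℝ) := by exact_mod_cast hM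
  have hPΔ : 0 < P / r.maxSpread := div_pos hP hΔ
  have hQm : Measurable Q := by
    have h1 : ∀ i j, Measurable fun p : Ω × (Fin K → Fin M → Bool) =>
        receiveMatrix a A B p.2 i j := fun i j =>
      (measurable_of_finite fun u => receiveMatrix a A B u i j).comp measurable_snd
    simp only [hQ, Matrix.mulVec, dotProduct]
    fun_prop
  have hset : {p : Ω × (Fin K → Fin M → Bool) | τ ≤ |r.rescale M P (∑ m, ‖channelOutput A B R
        (fun k m => ((√(r.power P k (s k)) * bitSign (p.2 k m) : ℝ) : ℂ)) p.1 m‖ ^ 2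
        - noiseEnergy μ B R) - ∑ k, r.inner k (s k)|}
      = {p | 2 * M * (P / r.maxSpread) * τ ≤ |Q p|} := by
    ext p
    have e1 := h.sum_norm_channelOutput_sq a p.2 p.1
    have e2 : r.rescale M P (∑ m, ‖channelOutput A B R (fun k m =>
        ((√(r.power P k (s k)) * bitSign (p.2 k m) : ℝ) : ℂ)) p.1 m‖ ^ 2 - noiseEnergy μ B R)
        - ∑ k, r.inner k (s k) = (2 * M * (P / r.maxSpread))⁻¹ * Q p := by
      rw [r.rescale_sub_sum hΔ hP hM, e1, hQ, hc']
      field_simp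
      ring
    have h2 : 0 < 2 * M * (P / r.maxSpread) := by positivity
    simp only [Set.mem_ofPred_eq]
    rw [e2, abs_mul, abs_of_pos (inv_pos.2 h2), le_inv_mul_iff₀ h2]
  rw [hset]
  have hL0 : 0 ≤ constL r P A B := sq_nonneg _
  have hF0 : 0 ≤ constF r P A B := mul_nonneg hL0 (sq_nonneg _)
  set N : ℝ := 64 * constF r P A B + 16 * τ * constL r P A B with hN
  have hN0 : 0 ≤ N := by positivity
  -- this order of the exponential moment is admissible, as `16 τ L ≤ N`, and as `64 F ≤ N` the
  -- variance term takes up at most half of `t * q`, where `q` is the deviation of `Q`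
  set t : ℝ := τ / (P / r.maxSpread * N) with ht
  have ht0 : 0 ≤ t := by positivity
  have hmgf : ∀ t' : ℝ, |t'| = t → ∫⁻ p, ENNReal.ofReal (Real.exp (t' * Q p)) ∂μ.prod (signLaw K M)
      ≤ ENNReal.ofReal (Real.exp (64 * t ^ 2 * ((P / r.maxSpread) ^ 2 * M * constF r P A B))) := by
    intro t' ht'
    refine (lintegral_exp_receive_le hXm hXi h.hasSubgaussianMGF hv ha0
      (r.sum_power_le hP.le hΔ.le s) A B ?_).trans_eq ?_
    · rw [sq_add_opNorm_eq r hΔ hP, ht', ht]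
      have e : 16 * (τ / (P / r.maxSpread * N)) * (P / r.maxSpread * constL r P A B)
          = 16 * τ * constL r P A B / N := by
        field_simp
      rw [e]
      refine div_le_one_of_le₀ ?_ hN0
      rw [hN]
      linarith
    · rw [sq_add_opNorm_eq r hΔ hP, sq_add_frobNorm_eq r hΔ hP hM, ← ht', sq_abs, constF]
      ring_nf
  refine (measureReal_abs_ge_le ht0 (hmgf t (abs_of_nonneg ht0))
    (hmgf (-t) (by rw [abs_neg, abs_of_nonneg ht0])) hQm).trans ?_
  refine mul_le_mul_of_nonneg_left (Real.exp_le_exp.2 ?_) zero_le_two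
  rcases hN0.eq_or_lt with h0 | h0
  · -- the denominator vanishes: `t = 0`, and the quotient on the right is `0` as well
    rw [ht, ← h0]
    simp
  · have e1 : 64 * t ^ 2 * ((P / r.maxSpread) ^ 2 * M * constF r P A B)
        = M * τ ^ 2 / N * (64 * constF r P A B / N) := by
      rw [ht]
      field_simp
    have e2 : t * (2 * M * (P / r.maxSpread) * τ) = 2 * (M * τ ^ 2 / N) := by
      rw [ht]
      field_simp
    have h3 : 64 * constF r P A B / N ≤ 1 := by
      refine div_le_one_of_le₀ ?_ hN0
      rw [hN]
      have : 0 ≤ 16 * τ * constL r P A B := by positivity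
      linarith
    have h4 : 0 ≤ M * τ ^ 2 / N := by positivity
    rw [e1, e2]
    nlinarith

theorem majorantInv_nonneg (Φ : ℝ → ℝ) (ε : ℝ) : 0 ≤ majorantInv Φ ε :=
  Real.sInf_nonneg fun _ ht => ht.1

theorem majorantInv_le {Φ : ℝ → ℝ} {ε t : ℝ} (ht : 0 ≤ t) (h : ε ≤ Φ t) : majorantInv Φ ε ≤ t :=
  csInf_le ⟨0, fun _ h => h.1⟩ ⟨ht, h⟩

end Scheme

theorem theorem1 {K : ℕ} (hK : 0 < K) (S : Fin K → Set ℝ) (hS : ∀ k, IsClosed (S k))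
    (f : (∀ k, S k) → ℝ) (r : NomographicRep S f) (hΔ : 0 < r.maxSpread)
    (Φ : ℝ → ℝ) (hΦ : r.IsIncrementMajorant Φ) :
    ∃ (G : ℝ → ℝ) (hG : Measurable G), (∀ x : r.dom, G x = r.outer x) ∧
      ∀ (M : ℕ) (_ : 0 < M) (P : ℝ) (hP : 0 < P)
        (Ω : Type*) [MeasurableSpace Ω] (μ : Measure Ω) [IsProbabilityMeasure μ]
        (R : SourceIdx K M → Ω → ℝ) (A Ai : Matrix (FadingIdx K M) (SourceIdx K M) ℝ)
        (B : Matrix (NoiseIdx M) (SourceIdx K M) ℝ) (η : ℝ),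
        IsCorrelatedChannel μ R A B →
        UserUncorrelated (mixed Ai R) μ →
        opNorm ((A + Ai) * (A - Ai)ᵀ) ≤ η →
        ∀ (s : ∀ k, S k) (ε : ℝ), 0 < ε → (∃ t : ℝ, 0 ≤ t ∧ ε ≤ Φ t) →
          (μ.prod (r.energyScheme G hG M P hP (noiseEnergy μ B R)).law).real
              {p | ε ≤ |(r.energyScheme G hG M P hP (noiseEnergy μ B R)).estimate A B R s p
                - f s|}
            ≤ 2 * Real.exp (-(M * majorantInv Φ ε ^ 2
                  / (16 * constF r P A B + constD r P η A B
                    + 4 * majorantInv Φ ε * constL r P A B)))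
              + 2 * Real.exp (-(M * majorantInv Φ ε ^ 2
                  / (256 * constF r P A B + 32 * majorantInv Φ ε * constL r P A B))) := by
  obtain ⟨G, hG, hGF, hGinc⟩ :=
    exists_measurable_extension r.dom_measurable r.outer_measurable hΦ.1 hΦ.2.2
  refine ⟨G, hG, hGF, ?_⟩
  intro M hM P hP Ω _ μ _ R A Ai B η hch _ _ s ε _ _
  set T := majorantInv Φ ε with hT
  have hT0 : 0 ≤ T := majorantInv_nonneg Φ ε
  set y : r.dom := ⟨∑ k, r.inner k (s k), r.sum_mem s⟩ with hy
  have hsub : {p | ε ≤ |(r.energyScheme G hG M P hP (noiseEnergy μ B R)).estimate A B R s p - f s|}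
      ⊆ {p | T / 2 ≤ |r.rescale M P (∑ m, ‖channelOutput A B R (fun k m =>
        ((√(r.power P k (s k)) * bitSign (p.2 k m) : ℝ) : ℂ)) p.1 m‖ ^ 2 - noiseEnergy μ B R)
        - ∑ k, r.inner k (s k)|} := by
    intro p hp
    rw [Set.mem_ofPred_eq, r.eq_outer s] at hp
    set x : ℝ := r.rescale M P (∑ m, ‖channelOutput A B R (fun k m =>
        ((√(r.power P k (s k)) * bitSign (p.2 k m) : ℝ) : ℂ)) p.1 m‖ ^ 2 - noiseEnergy μ B R)
      with hx
    have h1 : T ≤ 2 * |x - y| := by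
      refine le_of_forall_pos_le_add fun δ hδ => ?_
      exact majorantInv_le (by positivity) (le_trans hp (hGinc x y δ hδ))
    change T / 2 ≤ |x - y|
    linarith
  refine (measureReal_mono (μ := μ.prod (signLaw K M)) hsub).trans ?_
  refine (measureReal_rescale_ge_le r hΔ hM hP hch s (div_nonneg hT0 zero_le_two)).trans ?_
  -- at `T / 2` the bound is the second exponential
  have e : M * (T / 2) ^ 2 / (64 * constF r P A B + 16 * (T / 2) * constL r P A B)
      = M * T ^ 2 / (256 * constF r P A B + 32 * T * constL r P A B) := by
    rw [← mul_div_mul_left (M * (T / 2) ^ 2) _ (by norm_num : (4 : ℝ) ≠ 0)]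
    ring_nf
  rw [e]
  have := Real.exp_pos (-(M * T ^ 2 / (16 * constF r P A B + constD r P η A B
    + 4 * T * constL r P A B)))
  linarith
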